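/- Let $n,m$ be positive integers, let $\bm{k},\bm{\ell}\in\mathbb{Z}_{>0}^m$ satisfy $\sum_{i}k_i=\sum_j \ell_j=n$, and let $B=(b_{i,j})\in\mathbb{R}_{>0}^{m\times m}$. Let $A=A(B,\bm{k},\bm{\ell})\in\mathbb{R}_{>0}^{n\times n}$ be the block-constant matrix obtained from $B$ by expanding every entry $b_{i,j}$ into a constant block of size $k_i\times\ell_j$. Write $\bm{k}!=\prod_i k_i!$ and $\bm{t}^{\bm{k}}=\prod_i t_i^{k_i}$. For a non-negative matrix $A=(a_{i,j})$ of size $n\times n$ let $\mathrm{perm}(A)=\sum_{\sigma\in S_n}\prod_i a_{i,\sigma(i)}$, and let the degree-$M$ Bethe permanent be $$\mathrm{perm}_{\mathrm{B},M}(A)=\Bigl(\bigl\langle \mathrm{perm}(A^{\uparrow P})\bigr\rangle_{P}\Bigr)^{1/M},$$ where $\langle\cdot\rangle_P$ is the arithmetic average over all families $P=(P^{(i,j)})_{i,j\in[n]}$ of $M\times M$ permutation matrices, and $A^{\uparrow P}$ is the $Mn\times Mn$ matrix whose $(i,j)$ block is $a_{i,j}P^{(i,j)}$. For $\bm{t},\bm{u}\in\mathbb{R}_{>0}^m$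 let $S=S(\bm{t},\bm{u})=\mathrm{diag}(\bm{u})^{1/2}\,B^{\mathsf T}\,\mathrm{diag}(\bm{t})\,B\,\mathrm{diag}(\bm{u})^{1/2}$ and, for $\bm{t},\bm{u}$ sufficiently small, $$C^{\mathrm{G}}(\bm{t},\bm{u})=\exp\Bigl(\sum_{h\ge1}\frac{\mathrm{tr}(S^h)}{h}\Bigr),\qquad C^{\mathrm{B}}(\bm{t},\bm{u})=\exp\Bigl(\mathrm{tr}(S)+\sum_{h\ge2}\frac{\mathrm{tr}(S^h)}{2h}\Bigr).$$ Then $C^{\mathrm{G}}$ and $C^{\mathrm{B}}$ have unique power series expansions $\sum_{\bm{p},\bm{q}\in\mathbb{Z}_{\ge0}^m} c_{\bm{p},\bm{q}}\,\bm{t}^{\bm{p}}\bm{u}^{\bm{q}}$ about the origin (valid for all sufficiently small positive $\bm{t},\bm{u}$), and, with $[\bm{t}^{\bm{k}}\bm{u}^{\bm{\ell}}]$ denoting the coefficient $c_{\bm{k},\bm{\ell}}$ in the respective expansion, $$\mathrm{perm}(A)^2=\bm{k}!\,\bm{\ell}!\,[\bm{t}^{\bm{k}}\bm{u}^{\bm{\ell}}]\,C^{\mathrm{G}}(\bm{t},\bm{u}),\qquad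 \mathrm{perm}_{\mathrm{B},2}(A)^2=\bm{k}!\,\bm{\ell}!\,[\bm{t}^{\bm{k}}\bm{u}^{\bm{\ell}}]\,C^{\mathrm{B}}(\bm{t},\bm{u}).$$ -/

import Mathlib

open scoped BigOperators

noncomputable section

namespace BlockPermanent

/-- The block containing position `r`, when the `n` positions are split into `m` consecutive
blocks of sizes `k 0, k 1, …, k (m - 1)`. -/
def blockIndex {n m : ℕ} (k : Fin m → ℕ) (hk : ∑ i, k i = n) (r : Fin n) : Fin m :=
  (finSigmaFinEquiv.symm (Fin.cast hk.symm r)).1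

/-- The block-constant `n × n` matrix `A(B, k, ℓ)`, obtained by expanding each entry `b i j` of `B`
into a constant block of size `k i × ℓ j`. -/
def blockMatrix {n m : ℕ} (B : Matrix (Fin m) (Fin m) ℝ) (k ℓ : Fin m → ℕ)
    (hk : ∑ i, k i = n) (hℓ : ∑ j, ℓ j = n) : Matrix (Fin n) (Fin n) ℝ :=
  Matrix.of fun r c => B (blockIndex k hk r) (blockIndex ℓ hℓ c)

/-- The lifted `Mn × Mn` matrix of a degree-`M` cover: the block at `(i, j)` is `a i j` times the
permutation matrix of `P i j`. -/
def liftedMatrix {n M : ℕ} (A : Matrix (Fin n) (Fin n) ℝ)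
    (P : Fin n → Fin n → Equiv.Perm (Fin M)) : Matrix (Fin n × Fin M) (Fin n × Fin M) ℝ :=
  Matrix.of fun x y => A x.1 y.1 * (P x.1 y.1).permMatrix ℝ x.2 y.2

/-- The degree-`M` Bethe permanent: the `M`-th root of the arithmetic average of the permanents of
the lifted matrices over all degree-`M` cover configurations. -/
def bethePermanent {n : ℕ} (M : ℕ) (A : Matrix (Fin n) (Fin n) ℝ) : ℝ :=
  ((∑ P : Fin n → Fin n → Equiv.Perm (Fin M), (liftedMatrix A P).permanent) /
      (Fintype.card (Fin n → Fin n → Equiv.Perm (Fin M)) : ℝ)) ^ ((1 : ℝ) / (M : ℝ))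

/-- The matrix `S(t, u) = diag(u)^{1/2} Bᵀ diag(t) B diag(u)^{1/2}`. -/
def stateMatrix {m : ℕ} (B : Matrix (Fin m) (Fin m) ℝ) (t u : Fin m → ℝ) :
    Matrix (Fin m) (Fin m) ℝ :=
  Matrix.diagonal (fun j => Real.sqrt (u j)) * B.transpose * Matrix.diagonal t * B *
    Matrix.diagonal (fun j => Real.sqrt (u j))

/-- `C^G(t, u) = exp (∑_{h ≥ 1} tr(S(t, u)^h) / h)`. -/
def gibbsGF {m : ℕ} (B : Matrix (Fin m) (Fin m) ℝ) (t u : Fin m → ℝ) : ℝ :=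
  Real.exp (∑' h : ℕ, (stateMatrix B t u ^ (h + 1)).trace / ((h : ℝ) + 1))

/-- `C^B(t, u) = exp (tr(S(t, u)) + ∑_{h ≥ 2} tr(S(t, u)^h) / (2 h))`. -/
def betheGF {m : ℕ} (B : Matrix (Fin m) (Fin m) ℝ) (t u : Fin m → ℝ) : ℝ :=
  Real.exp ((stateMatrix B t u).trace +
    ∑' h : ℕ, (stateMatrix B t u ^ (h + 2)).trace / (2 * ((h : ℝ) + 2)))

/-- `c` is the family of coefficients of a power series expansion about the origin of the function
`f`, which is considered at positive arguments only: for all sufficiently small positive vectors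
`t`, `u`, the series `∑ c (p, q) t^p u^q` over all `p, q ∈ ℕ^m` converges (absolutely)
to `f t u`. -/
def IsPowerSeriesExpansion {m : ℕ} (f : (Fin m → ℝ) → (Fin m → ℝ) → ℝ)
    (c : (Fin m → ℕ) × (Fin m → ℕ) → ℝ) : Prop :=
  ∃ ε : ℝ, 0 < ε ∧ ∀ t u : Fin m → ℝ, (∀ i, 0 < t i ∧ t i < ε) → (∀ j, 0 < u j ∧ u j < ε) →
    HasSum (fun r : (Fin m → ℕ) × (Fin m → ℕ) =>
      c r * (∏ i, t i ^ r.1 i) * (∏ j, u j ^ r.2 j)) (f t u)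

/-- `k! = ∏ i, (k i)!` as a real number. -/
def multiFactorial {m : ℕ} (k : Fin m → ℕ) : ℝ := ∏ i, (Nat.factorial (k i) : ℝ)

end BlockPermanent

end

/-!
Both identities are instances of one identity with a parameter `θ`. For an `n × n` matrix `A` put
`pairSum θ A = ∑ σ τ, θ ^ c(σ⁻¹ τ) * ∏ j, A (σ j) j * A (τ j) j`, where `c` counts the cycles of
length at least 2. Trivially `perm(A) ^ 2 = pairSum 1 A` (`permanent_sq`), and
`perm_{B,2}(A) ^ 2 = pairSum (1 / 2) A` (`bethePermanent_two_sq`).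

The second equality comes from averaging `perm(A^{↑P})` term by term. A permutation `ρ` of
`Fin n × Fin 2` survives with probability `1 / 2` or `1 / 4` per column, according to whether the
two points above that column are sent to the same row or to two different ones. The surviving
weight does not change when the two points above a column are exchanged. By Hall's theorem, some
choice of exchanges makes `ρ` layered, that is, a pair `(σ, τ)` of permutations together with an
irrelevant labelling (`exists_isLayered_mul`), and if `ρ` is layered, then exactly `2` to the
number of all cycles of `σ⁻¹ τ` choices keep it layered (`layeringCount_layered`).

For the generating function, the factors `k!` and `ℓ!` turn the coefficient at `t^k u^ℓ` into a
sum over all words of contents `k` and `ℓ` (`pairSum_blockMatrix`). So the whole series is, for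
each `n`, a sum over all pairs of words of length `n`. Summing over the words first leaves
`1 / n! * ∑ π, θ ^ c(π) * (closed walk sum of π)` for the matrix `M = diag(t) B diag(u) Bᵀ`
(`sum_words_pairSum`). The closed walk sum is the product of `tr(M ^ h) = tr(S ^ h)` over the
cycle lengths `h` of `π` (`closedWalkSum_eq`), and the exponential formula for permutations
(`hasSum_cycleIndex`) sums the result to `exp (tr M + ∑_{h ≥ 2} θ * tr(M ^ h) / h)`. All terms are
non-negative, which settles every question of convergence. The expansion is unique because its
homogeneous parts can be read off along rays (`eq_zero_of_hasSum_monomials_zero`).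
-/

namespace BlockPermanent

open Equiv Finset

/-! ### Closed walks along the cycles of a permutation -/

section ClosedWalks

variable {α β ι R : Type*} [Fintype α] [Fintype β] [Fintype ι] [CommRing R]

/-- The sum, over all labellings `b` of `α` by indices of `M`, of `∏ i, M (b i) (b (π i))`. Each
cycle of `π` contributes the weights of a closed walk of the same length. -/
def closedWalkSum (M : Matrix ι ι R) [DecidableEq α] (π : Perm α) : R :=
  ∑ b : α → ι, ∏ i, M (b i) (b (π i))

variable [DecidableEq α] [DecidableEq β]

theorem closedWalkSum_permCongr (M : Matrix ι ι R) (e : α ≃ β) (π : Perm α) :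
    closedWalkSum M (e.permCongr π) = closedWalkSum M π := by
  unfold closedWalkSum
  refine Fintype.sum_equiv (e.arrowCongr (Equiv.refl ι)).symm _ _ fun b => ?_
  refine Fintype.prod_equiv e.symm _ _ fun i => ?_
  simp [Equiv.permCongr_apply]

theorem closedWalkSum_eq_of_isConj (M : Matrix ι ι R) {π π' : Perm α} (h : IsConj π π') :
    closedWalkSum M π = closedWalkSum M π' := by
  obtain ⟨c, hc⟩ := isConj_iff.1 h
  rw [← hc, ← closedWalkSum_permCongr M c π]
  rfl

theorem closedWalkSum_one (M : Matrix ι ι R) :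
    closedWalkSum M (1 : Perm α) = M.trace ^ Fintype.card α := by
  classical
  unfold closedWalkSum
  simp only [Perm.one_apply]
  rw [← Fintype.piFinset_univ, ← Finset.prod_univ_sum (fun _ : α => (univ : Finset ι))
    (fun _ x => M x x)]
  simp [Matrix.trace]

theorem closedWalkSum_subtypePerm (M : Matrix ι ι R) (π : Perm α) (p : α → Prop)
    [DecidablePred p] (h : ∀ x, p (π x) ↔ p x) :
    closedWalkSum M π = closedWalkSum M (π.subtypePerm h) *
      closedWalkSum M (π.subtypePerm (p := fun x => ¬ p x) fun x => not_congr (h x)) := by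
  unfold closedWalkSum
  rw [Fintype.sum_mul_sum, ← Fintype.sum_prod_type']
  refine Fintype.sum_equiv (Equiv.piEquivPiSubtypeProd p fun _ => ι) _ _ fun b => ?_
  rw [← Fintype.prod_subtype_mul_prod_subtype p]
  rfl

/-- The entries of `M ^ n` as sums over walks, tested against an arbitrary function `G` of the two
end points. -/
theorem sum_walk (M : Matrix ι ι R) [DecidableEq ι] (n : ℕ) (G : ι → ι → R) :
    ∑ b : Fin (n + 1) → ι, (∏ i : Fin n, M (b i.castSucc) (b i.succ)) * G (b 0) (b (Fin.last n)) =
      ∑ x, ∑ y, (M ^ n) x y * G x y := by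
  induction n generalizing G with
  | zero =>
    rw [← (Equiv.funUnique (Fin 1) ι).symm.sum_comp]
    simp [Matrix.one_apply]
  | succ n ih =>
    rw [← (Fin.consEquiv fun _ => ι).sum_comp, Fintype.sum_prod_type]
    refine Finset.sum_congr rfl fun x _ => ?_
    have key := ih fun z y => M x z * G x y
    calc _ = ∑ b : Fin (n + 1) → ι, (∏ i : Fin n, M (b i.castSucc) (b i.succ)) *
            (M x (b 0) * G x (b (Fin.last n))) := by
          refine Finset.sum_congr rfl fun b _ => ?_
          rw [Fin.prod_univ_succ]
          simp only [Fin.consEquiv_apply, Fin.castSucc_zero, Fin.cons_zero, Fin.cons_succ,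
            ← Fin.succ_last, ← Fin.succ_castSucc]
          ring
      _ = _ := by
          rw [key, Finset.sum_comm]
          refine Finset.sum_congr rfl fun y _ => ?_
          rw [pow_succ', Matrix.mul_apply, Finset.sum_mul]
          exact Finset.sum_congr rfl fun z _ => by ring

theorem closedWalkSum_finRotate (M : Matrix ι ι R) [DecidableEq ι] (n : ℕ) :
    closedWalkSum M (finRotate (n + 1)) = (M ^ (n + 1)).trace := by
  have key := sum_walk M n fun x y => M y x
  rw [pow_succ, Matrix.trace]
  simp only [Matrix.diag_apply, Matrix.mul_apply]
  rw [← key]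
  refine Finset.sum_congr rfl fun b _ => ?_
  rw [Fin.prod_univ_castSucc]
  simp

theorem cycleType_permCongr (e : α ≃ β) (π : Perm α) :
    (e.permCongr π).cycleType = π.cycleType := by
  let f : α ≃ {x : β // True} := e.trans (Equiv.subtypeUnivEquiv fun _ => trivial).symm
  rw [← Perm.cycleType_extendDomain f (g := π)]
  congr 1

theorem closedWalkSum_isCycle (M : Matrix ι ι R) [DecidableEq ι] {π : Perm α} (hπ : π.IsCycle) :
    closedWalkSum M π =
      M.trace ^ (Fintype.card α - #π.support) * (M ^ #π.support).trace := by
  have hp : ∀ x, π (π x) ≠ π x ↔ π x ≠ x := fun x => by simp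
  have hsupp : Fintype.card {x // π x ≠ x} = #π.support := by
    rw [Fintype.card_subtype]; rfl
  rw [closedWalkSum_subtypePerm M π (fun x => π x ≠ x) hp, mul_comm]
  congr 1
  · have : (π.subtypePerm (p := fun x => ¬ π x ≠ x) fun x => not_congr (hp x)) = 1 := by
      ext x
      simpa using x.2
    rw [this, closedWalkSum_one, Fintype.card_subtype_compl, hsupp]
  · obtain ⟨n, hn⟩ : ∃ n, #π.support = n + 2 :=
      ⟨#π.support - 2, by have := hπ.two_le_card_support; omega⟩
    have hcard : Fintype.card {x // π x ≠ x} = Fintype.card (Fin (n + 2)) := by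
      rw [hsupp, hn, Fintype.card_fin]
    let e := Fintype.equivOfCardEq hcard
    rw [hn, ← closedWalkSum_finRotate, ← closedWalkSum_permCongr M e]
    apply closedWalkSum_eq_of_isConj
    rw [Perm.isConj_iff_cycleType_eq, cycleType_permCongr, cycleType_finRotate,
      ← Perm.cycleType_ofSubtype, Perm.ofSubtype_subtypePerm hp fun x hx => hx, hπ.cycleType, hn]

/-- The closed walk sum factors over the cycles of `π`: a cycle of length `h` contributes the
trace of `M ^ h`. The hypothesis on the trace allows a comparison after multiplication by powers of
`M.trace`, in place of a definition of the sum on subsets. -/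
theorem closedWalkSum_eq (M : Matrix ι ι R) [DecidableEq ι] [IsDomain R] (hM : M.trace ≠ 0)
    (π : Perm α) :
    closedWalkSum M π = M.trace ^ (Fintype.card α - π.cycleType.sum) *
      (π.cycleType.map fun h => (M ^ h).trace).prod := by
  induction π using Perm.cycle_induction_on with
  | base_one => simp [closedWalkSum_one]
  | base_cycles σ hσ => simp [closedWalkSum_isCycle M hσ, hσ.cycleType]
  | induction_disjoint σ τ hd hc h1 h2 =>
    have hp : ∀ x, σ (σ x) ≠ σ x ↔ σ x ≠ x := fun x => by simp
    have hq : ∀ x, σ (τ x) ≠ τ x ↔ σ x ≠ x := fun x => by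
      rw [← Perm.mul_apply, hd.commute.eq, Perm.mul_apply, τ.injective.ne_iff]
    have hpq : ∀ x, σ ((σ * τ) x) ≠ (σ * τ) x ↔ σ x ≠ x := fun x => by
      rw [Perm.mul_apply, hp, hq]
    -- `α` is split into the support of `σ` and its complement, on which `σ * τ` agrees with `σ` and
    -- with `τ`, respectively
    have e1 := closedWalkSum_subtypePerm M σ (fun x => σ x ≠ x) hp
    have e2 := closedWalkSum_subtypePerm M τ (fun x => σ x ≠ x) hq
    have e3 := closedWalkSum_subtypePerm M (σ * τ) (fun x => σ x ≠ x) hpq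
    have f1 : (σ.subtypePerm (p := fun x => ¬ σ x ≠ x) fun x => not_congr (hp x)) = 1 := by
      ext x
      simpa using x.2
    have f2 : τ.subtypePerm (p := fun x => σ x ≠ x) hq = 1 := by
      ext x
      simpa [x.2] using hd x
    have f3 : (σ * τ).subtypePerm (p := fun x => σ x ≠ x) hpq =
        σ.subtypePerm (p := fun x => σ x ≠ x) hp := by
      ext x
      have := (hd x).resolve_left x.2
      simp [this]
    have f4 : ((σ * τ).subtypePerm (p := fun x => ¬ σ x ≠ x) fun x => not_congr (hpq x)) =
        τ.subtypePerm (p := fun x => ¬ σ x ≠ x) fun x => not_congr (hq x) := by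
      ext x
      have hx := (not_congr (hq x)).2 x.2
      rw [not_not] at hx
      simp [hx]
    rw [f1, closedWalkSum_one] at e1
    rw [f2, closedWalkSum_one] at e2
    rw [f3, f4] at e3
    have hle := (σ * τ).sum_cycleType_le
    rw [hd.cycleType_mul] at hle ⊢
    rw [Multiset.sum_add] at hle ⊢
    have hcard : Fintype.card {x // σ x ≠ x} + Fintype.card {x // ¬ σ x ≠ x} =
        Fintype.card α := by
      rw [Fintype.card_subtype_compl fun x => σ x ≠ x]
      exact Nat.add_sub_cancel' (Fintype.card_subtype_le fun x => σ x ≠ x)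
    apply mul_left_cancel₀ (pow_ne_zero (Fintype.card α) hM)
    calc _ = closedWalkSum M σ * closedWalkSum M τ := by
          rw [e1, e2, e3, ← hcard, pow_add]; ring
      _ = _ := by
          rw [h1, h2, Multiset.map_add, Multiset.prod_add]
          have : M.trace ^ Fintype.card α * M.trace ^ (Fintype.card α -
              (σ.cycleType.sum + τ.cycleType.sum)) = M.trace ^ (Fintype.card α - σ.cycleType.sum) *
              M.trace ^ (Fintype.card α - τ.cycleType.sum) := by
            rw [← pow_add, ← pow_add]; congr 1; omega
          linear_combination (-1 : R) * this *
            (σ.cycleType.map fun h => (M ^ h).trace).prod *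
            (τ.cycleType.map fun h => (M ^ h).trace).prod

end ClosedWalks

/-! ### The exponential formula for permutations -/

section ExponentialFormula

open scoped Nat

/-- The case of `hasSum_multiset` in which only the indices in `s` occur. -/
theorem hasSum_multiset_of_finset (q : ℕ → ℝ) (hq : ∀ i, 0 ≤ q i) (s : Finset ℕ) :
    HasSum (fun m : Multiset ℕ =>
      if m.toFinset ⊆ s then ∏ i ∈ s, q i ^ m.count i / (m.count i)! else 0)
      (Real.exp (∑ i ∈ s, q i)) := by
  induction s using Finset.induction_on with
  | empty =>
    simp only [Finset.subset_empty, Multiset.toFinset_eq_empty, Finset.prod_empty,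
      Finset.sum_empty, Real.exp_zero]
    exact hasSum_ite_eq 0 1
  | insert a s ha ih =>
    have h1 : HasSum (fun k : ℕ => q a ^ k / k !) (Real.exp (q a)) := by
      rw [Real.exp_eq_exp_ℝ]
      exact NormedSpace.expSeries_div_hasSum_exp (q a)
    set f : Multiset ℕ → ℝ := fun m =>
      if m.toFinset ⊆ s then ∏ i ∈ s, q i ^ m.count i / (m.count i)! else 0 with hf
    have hf0 : 0 ≤ f := fun m => by
      simp only [hf, Pi.zero_apply]
      split_ifs
      · exact Finset.prod_nonneg fun i _ => div_nonneg (pow_nonneg (hq i) _) (by positivity)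
      · exact le_rfl
    have h10 : (0 : ℕ → ℝ) ≤ fun k => q a ^ k / k ! :=
      fun k => div_nonneg (pow_nonneg (hq a) k) (by positivity)
    have h2 := h1.mul ih (h1.summable.mul_of_nonneg ih.summable h10 hf0)
    rw [Finset.sum_insert ha, Real.exp_add]
    -- a multiset is a multiplicity of `a` and a multiset without `a`
    let κ : Multiset ℕ → ℕ × Multiset ℕ := fun m => (m.count a, m.filter (· ≠ a))
    have hκ : Function.Injective κ := by
      intro m m' h
      simp only [κ, Prod.mk.injEq] at h
      ext i
      by_cases hi : i = a
      · rw [hi, h.1]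
      · have := congrArg (Multiset.count i) h.2
        simpa [Multiset.count_filter, hi] using this
    rw [← hκ.hasSum_iff] at h2
    · convert! h2 using 2 with m
      have hsub : (m.filter (· ≠ a)).toFinset ⊆ s ↔ m.toFinset ⊆ insert a s := by
        simp only [Finset.subset_iff, Multiset.mem_toFinset, Multiset.mem_filter,
          Finset.mem_insert]
        exact forall_congr' fun i => by tauto
      simp only [Function.comp_apply, κ, hf, hsub, mul_ite, mul_zero, Finset.prod_insert ha]
      congr 2
      refine Finset.prod_congr rfl fun i hi => ?_
      have hia : i ≠ a := fun h => ha (h ▸ hi)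
      simp [hia]
    · rintro ⟨k, m⟩ hkm
      have : a ∈ m := by
        by_contra hm
        refine hkm ⟨m + Multiset.replicate k a, ?_⟩
        simp only [κ, Prod.mk.injEq]
        constructor
        · simp [hm]
        · ext i
          by_cases hi : i = a
          · subst hi; simp [hm]
          · simp [hi, Multiset.count_replicate, Ne.symm hi]
      have hsub : ¬ m.toFinset ⊆ s := fun h => ha (h (Multiset.mem_toFinset.2 this))
      simp [hf, hsub]

/-- The exponential of a series of non-negative terms, expanded over multisets of indices. -/
theorem hasSum_multiset (q : ℕ → ℝ) (hq : ∀ i, 0 ≤ q i) (hs : Summable q) :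
    HasSum (fun m : Multiset ℕ => ∏ i ∈ m.toFinset, q i ^ m.count i / (m.count i)!)
      (Real.exp (∑' i, q i)) := by
  set Q : Multiset ℕ → ℝ := fun m => ∏ i ∈ m.toFinset, q i ^ m.count i / (m.count i)! with hQdef
  have hQ0 : ∀ m, 0 ≤ Q m := fun m =>
    Finset.prod_nonneg fun i _ => div_nonneg (pow_nonneg (hq i) _) (by positivity)
  have hQ : ∀ (s : Finset ℕ) (m : Multiset ℕ), m.toFinset ⊆ s →
      ∏ i ∈ s, q i ^ m.count i / (m.count i)! = Q m := fun s m h => by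
    refine (Finset.prod_subset h fun i _ hi => ?_).symm
    rw [Multiset.mem_toFinset] at hi
    simp [hi]
  have hbound : ∀ F : Finset (Multiset ℕ), ∑ m ∈ F, Q m ≤ Real.exp (∑' i, q i) := fun F => by
    set s := F.biUnion Multiset.toFinset
    calc ∑ m ∈ F, Q m = ∑ m ∈ F, (if m.toFinset ⊆ s then
          ∏ i ∈ s, q i ^ m.count i / (m.count i)! else 0) := by
          refine Finset.sum_congr rfl fun m hm => ?_
          have hms : m.toFinset ⊆ s := Finset.subset_biUnion_of_mem Multiset.toFinset hm
          rw [if_pos hms, hQ s m hms]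
      _ ≤ Real.exp (∑ i ∈ s, q i) := by
          refine sum_le_hasSum F (fun m _ => ?_) (hasSum_multiset_of_finset q hq s)
          split_ifs with h
          · rw [hQ s m h]; exact hQ0 m
          · exact le_rfl
      _ ≤ _ := Real.exp_le_exp.2 (hs.sum_le_tsum s fun i _ => hq i)
  have hsum : Summable Q := summable_of_sum_le hQ0 hbound
  refine (hsum.hasSum_iff).2 (le_antisymm (hsum.tsum_le_of_sum_le hbound) ?_)
  refine le_of_tendsto ((Real.continuous_exp.tendsto _).comp hs.hasSum)
    (Filter.Eventually.of_forall fun s => ?_)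
  refine hasSum_le (fun m => ?_) (hasSum_multiset_of_finset q hq s) hsum.hasSum
  split_ifs with h
  · exact (hQ s m h).le
  · exact hQ0 m

/-- The exponential formula for permutations: the average over `Perm (Fin n)` of the product over
all cycles (fixed points included) of weights `p h`, summed over all `n`, is `exp (∑ p h / h)`. The
term `h = 1` stands apart because `Equiv.Perm.cycleType` omits the fixed points. -/
theorem hasSum_cycleIndex (p : ℕ → ℝ) (hp : ∀ h, 0 ≤ p h)
    (hs : Summable fun h : ℕ => p (h + 2) / ((h : ℝ) + 2)) :
    HasSum (fun n : ℕ => (∑ π : Perm (Fin n),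
      p 1 ^ (n - π.cycleType.sum) * (π.cycleType.map p).prod) / n !)
      (Real.exp (p 1 + ∑' h : ℕ, p (h + 2) / ((h : ℝ) + 2))) := by
  -- multisets with a part below 2 are not cycle types; `q` gives them the weight zero
  set q : ℕ → ℝ := fun h => if 2 ≤ h then p h / h else 0 with hqdef
  have hq : ∀ h, 0 ≤ q h := fun h => by
    simp only [hqdef]
    split_ifs
    · exact div_nonneg (hp h) (Nat.cast_nonneg h)
    · exact le_rfl
  have hq2 : (fun h => q (h + 2)) = fun h : ℕ => p (h + 2) / ((h : ℝ) + 2) := by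
    ext h
    simp [hqdef]
  have hqs : Summable q := by
    rw [← summable_nat_add_iff 2, hq2]
    exact hs
  have htsum : ∑' h, q h = ∑' h : ℕ, p (h + 2) / ((h : ℝ) + 2) := by
    rw [← hqs.sum_add_tsum_nat_add 2, hq2]
    simp [hqdef, Finset.sum_range_succ]
  set Q : Multiset ℕ → ℝ := fun m => ∏ i ∈ m.toFinset, q i ^ m.count i / (m.count i)! with hQdef
  have hQ0 : ∀ m, 0 ≤ Q m := fun m =>
    Finset.prod_nonneg fun i _ => div_nonneg (pow_nonneg (hq i) _) (by positivity)
  have h1 : HasSum (fun k : ℕ => p 1 ^ k / k !) (Real.exp (p 1)) := by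
    rw [Real.exp_eq_exp_ℝ]
    exact NormedSpace.expSeries_div_hasSum_exp (p 1)
  have h2 := hasSum_multiset q hq hqs
  have h3 := h1.mul h2 (h1.summable.mul_of_nonneg h2.summable
    (fun k => div_nonneg (pow_nonneg (hp 1) k) (by positivity)) hQ0)
  rw [← Real.exp_add, htsum] at h3
  -- `(f, m)` stands for the permutations of `f + m.sum` points with `f` fixed points and cycle
  -- type `m`
  have h4 := ((Equiv.sigmaFiberEquiv fun x : ℕ × Multiset ℕ => x.1 + x.2.sum).hasSum_iff).2 h3
  refine h4.sigma fun n => ?_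
  -- the number of permutations of a given cycle type
  have hcount : ∀ m : Multiset ℕ,
      (if m.sum ≤ n then p 1 ^ (n - m.sum) / (n - m.sum)! * Q m else 0) =
      #{π : Perm (Fin n) | π.cycleType = m} •
        (p 1 ^ (n - m.sum) * (m.map p).prod / n !) := fun m => by
    by_cases hm : m.sum ≤ n ∧ ∀ a ∈ m, 2 ≤ a
    · have hc := Perm.card_of_cycleType_mul_eq (Fin n) m
      rw [Fintype.card_fin, if_pos hm] at hc
      have hc' := congrArg (Nat.cast : ℕ → ℝ) hc
      simp only [Nat.cast_mul, Nat.cast_prod] at hc'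
      have hprod : (m.prod : ℝ) ≠ 0 := by
        have : m.prod ≠ 0 := Multiset.prod_ne_zero fun h => by have := hm.2 0 h; omega
        exact_mod_cast this
      have hfac : (∏ i ∈ m.toFinset, ((m.count i)! : ℝ)) ≠ 0 :=
        Finset.prod_ne_zero_iff.2 fun i _ => by positivity
      have hQm : Q m * (m.prod * ∏ i ∈ m.toFinset, ((m.count i)! : ℝ)) = (m.map p).prod := by
        simp only [hQdef]
        rw [Finset.prod_multiset_count m, Nat.cast_prod, ← Finset.prod_mul_distrib,
          ← Finset.prod_mul_distrib, Finset.prod_multiset_map_count]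
        refine Finset.prod_congr rfl fun i hi => ?_
        have h2i := hm.2 i (Multiset.mem_toFinset.1 hi)
        have hi0 : (i : ℝ) ≠ 0 := by positivity
        simp only [hqdef, if_pos h2i]
        rw [Nat.cast_pow, div_pow]
        field_simp
      have hn : ((n)! : ℝ) ≠ 0 := by positivity
      have hnm : ((n - m.sum)! : ℝ) ≠ 0 := by positivity
      rw [if_pos hm.1, ← hQm, nsmul_eq_mul]
      field_simp
      linear_combination (-(p 1 ^ (n - m.sum)) * Q m) * hc'
    · rw [(Perm.card_of_cycleType_eq_zero_iff (Fin n)).2 (by simpa using hm), zero_smul]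
      split_ifs with h
      · push Not at hm
        obtain ⟨a, ha, ha2⟩ := hm h
        have : Q m = 0 := by
          refine Finset.prod_eq_zero (Multiset.mem_toFinset.2 ha) ?_
          simp [hqdef, Nat.not_le.2 ha2, Multiset.count_eq_zero, ha]
        rw [this, mul_zero]
      · rfl
  let ψ : {x : ℕ × Multiset ℕ // x.1 + x.2.sum = n} → Multiset ℕ := fun x => x.1.2
  have hψ : Function.Injective ψ := by
    rintro ⟨⟨k, m⟩, h⟩ ⟨⟨k', m'⟩, h'⟩ (hmm : m = m')
    subst hmm
    simp only [Subtype.mk.injEq, Prod.mk.injEq, and_true]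
    simp only at h h'
    omega
  have h5 : HasSum (fun m : Multiset ℕ =>
      if m.sum ≤ n then p 1 ^ (n - m.sum) / (n - m.sum)! * Q m else 0)
      ((∑ π : Perm (Fin n), p 1 ^ (n - π.cycleType.sum) * (π.cycleType.map p).prod) / n !) := by
    rw [Finset.sum_div, Finset.sum_comp (fun m : Multiset ℕ =>
      p 1 ^ (n - m.sum) * (m.map p).prod / (n ! : ℝ)) Perm.cycleType]
    simp only [← hcount]
    refine hasSum_sum_of_ne_finset_zero fun m hm => ?_
    rw [hcount, Finset.card_eq_zero.2, zero_smul]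
    refine Finset.filter_eq_empty_iff.2 fun π _ h => hm ?_
    exact Finset.mem_image.2 ⟨π, Finset.mem_univ _, h⟩
  rw [← hψ.hasSum_iff] at h5
  · convert! h5 using 2 with x
    obtain ⟨⟨k, m⟩, h⟩ := x
    simp only at h
    have hk : k = n - m.sum := by omega
    have hle : m.sum ≤ n := by omega
    simp [ψ, hle, hk, Equiv.sigmaFiberEquiv, Q]
  · intro m hm
    refine if_neg fun hle => hm ⟨⟨(n - m.sum, m), by simp only; omega⟩, rfl⟩

end ExponentialFormula

/-! ### Uniqueness of power series expansions -/

section Uniqueness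

/-- One-variable uniqueness: if all coefficients before `a N` vanish, then `|a N| ≤ s * ∑ |a n|` for
all small positive `s`. -/
theorem eq_zero_of_hasSum_pow_zero (a : ℕ → ℝ)
    (h : ∀ s : ℝ, 0 < s → s ≤ 1 → HasSum (fun n => a n * s ^ n) 0) (N : ℕ) : a N = 0 := by
  induction N using Nat.strong_induction_on with
  | _ N ih =>
    have ha : Summable fun n => |a n| := by
      simpa using (h 1 one_pos le_rfl).summable.abs
    have key : ∀ s : ℝ, 0 < s → s ≤ 1 → |a N| ≤ s * ∑' n, |a n| := fun s h0 h1 => by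
      have hs := h s h0 h1
      have hsplit := hs.summable.sum_add_tsum_nat_add (N + 1)
      have hz : ∑ i ∈ Finset.range N, a i * s ^ i = 0 := Finset.sum_eq_zero fun i hi => by
        rw [ih i (Finset.mem_range.1 hi), zero_mul]
      rw [hs.tsum_eq, Finset.sum_range_succ, hz, zero_add] at hsplit
      have hN : a N * s ^ N = - ∑' i, a (i + (N + 1)) * s ^ (i + (N + 1)) := by linarith
      have htail : Summable fun i => |a (i + (N + 1))| :=
        (summable_nat_add_iff (f := fun i => |a i|) (N + 1)).2 ha
      have hb : |∑' i, a (i + (N + 1)) * s ^ (i + (N + 1))| ≤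
          ∑' i, s ^ (N + 1) * |a (i + (N + 1))| := by
        have hbs := (htail.mul_left (s ^ (N + 1))).hasSum
        have hterm : ∀ i, ‖a (i + (N + 1)) * s ^ (i + (N + 1))‖ ≤
            s ^ (N + 1) * |a (i + (N + 1))| := fun i => by
          rw [Real.norm_eq_abs, abs_mul, abs_of_pos (pow_pos h0 _), mul_comm]
          exact mul_le_mul_of_nonneg_right
            (pow_le_pow_of_le_one h0.le h1 (Nat.le_add_left _ _)) (abs_nonneg _)
        exact tsum_of_norm_bounded hbs hterm
      have hle : ∑' i, |a (i + (N + 1))| ≤ ∑' n, |a n| := by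
        have h1 := ha.sum_add_tsum_nat_add (N + 1)
        have h2 : 0 ≤ ∑ i ∈ Finset.range (N + 1), |a i| := Finset.sum_nonneg fun i _ => abs_nonneg _
        linarith
      have h3 : |a N| * s ^ N ≤ (s * ∑' n, |a n|) * s ^ N := by
        calc |a N| * s ^ N = |a N * s ^ N| := by rw [abs_mul, abs_of_pos (pow_pos h0 N)]
          _ ≤ ∑' i, s ^ (N + 1) * |a (i + (N + 1))| := by rw [hN, abs_neg]; exact hb
          _ = s ^ (N + 1) * ∑' i, |a (i + (N + 1))| := by rw [tsum_mul_left]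
          _ ≤ s ^ (N + 1) * ∑' n, |a n| := mul_le_mul_of_nonneg_left hle (pow_pos h0 _).le
          _ = (s * ∑' n, |a n|) * s ^ N := by rw [pow_succ]; ring
      exact le_of_mul_le_mul_right h3 (pow_pos h0 N)
    by_contra hne
    have hpos : 0 < |a N| := abs_pos.2 hne
    set T := ∑' n, |a n|
    have hT : 0 ≤ T := tsum_nonneg fun n => abs_nonneg _
    have hT1 : |a N| ≤ T := by simpa using key 1 one_pos le_rfl
    have hT0 : 0 < T := hpos.trans_le hT1
    -- this `s` would give `|a N| ≤ |a N| / 2`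
    have := key (|a N| / (2 * T)) (by positivity) (by rw [div_le_one (by positivity)]; linarith)
    have h2 : |a N| / (2 * T) * T = |a N| / 2 := by field_simp
    linarith

/-- A multivariate power series that converges to zero on a box of small positive arguments has
only zero coefficients: on each ray its homogeneous parts vanish, and these are polynomials. -/
theorem eq_zero_of_hasSum_monomials_zero {σ : Type*} [Fintype σ] (d : (σ → ℕ) → ℝ) {δ : ℝ}
    (hδ : 0 < δ) (h : ∀ x : σ → ℝ, (∀ i, 0 < x i ∧ x i < δ) →
      HasSum (fun r : σ → ℕ => d r * ∏ i, x i ^ r i) 0) : d = 0 := by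
  classical
  have hhom : ∀ (N : ℕ) (x : σ → ℝ), (∀ i, 0 < x i ∧ x i < δ) →
      ∑ r ∈ piAntidiag (univ : Finset σ) N, d r * ∏ i, x i ^ r i = 0 := by
    intro N x hx
    refine eq_zero_of_hasSum_pow_zero
      (fun N => ∑ r ∈ piAntidiag (univ : Finset σ) N, d r * ∏ i, x i ^ r i) (fun s h0 h1 => ?_) N
    have hs := h (fun i => s * x i) fun i => ⟨mul_pos h0 (hx i).1,
      (mul_le_of_le_one_left (hx i).1.le h1).trans_lt (hx i).2⟩
    have hs' := ((Equiv.sigmaFiberEquiv fun r : σ → ℕ => ∑ i, r i).hasSum_iff).2 hs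
    refine hs'.sigma fun n => ?_
    have hfin : HasSum (fun r : σ → ℕ => if ∑ i, r i = n then
        d r * ∏ i, (s * x i) ^ r i else 0)
        (∑ r ∈ piAntidiag (univ : Finset σ) n,
          if ∑ i, r i = n then d r * ∏ i, (s * x i) ^ r i else 0) := by
      refine hasSum_sum_of_ne_finset_zero fun r hr => if_neg fun h => hr ?_
      simp [h]
    rw [← (Subtype.val_injective (p := fun r : σ → ℕ => ∑ i, r i = n)).hasSum_iff] at hfin
    · convert! hfin using 1
      · funext r
        simp [r.2, Equiv.sigmaFiberEquiv]
      · rw [Finset.sum_mul]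
        refine Finset.sum_congr rfl fun r hr => ?_
        have hrn : ∑ i, r i = n := by simpa using hr
        rw [if_pos hrn]
        simp only [mul_pow]
        rw [Finset.prod_mul_distrib, Finset.prod_pow_eq_pow_sum, hrn]
        ring
    · intro r hr
      exact if_neg fun h => hr ⟨⟨r, h⟩, rfl⟩
  funext r₀
  set N := ∑ i, r₀ i with hN
  let P : MvPolynomial σ ℝ := ∑ r ∈ piAntidiag (univ : Finset σ) N,
    MvPolynomial.monomial (Finsupp.equivFunOnFinite.symm r) (d r)
  have hP : P = 0 := by
    refine MvPolynomial.funext_set (fun _ => Set.Ioo 0 δ) (fun _ => Set.Ioo_infinite hδ)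
      fun x hx => ?_
    have := hhom N x fun i => hx i trivial
    rw [map_zero, ← this, map_sum]
    refine Finset.sum_congr rfl fun r _ => ?_
    rw [MvPolynomial.eval_monomial, Finsupp.prod_fintype _ _ fun i => pow_zero _]
    simp
  have hc := congrArg (MvPolynomial.coeff (Finsupp.equivFunOnFinite.symm r₀)) hP
  rw [MvPolynomial.coeff_sum, Finset.sum_eq_single r₀, MvPolynomial.coeff_monomial, if_pos rfl]
    at hc
  · simpa using hc
  · intro r _ hr
    rw [MvPolynomial.coeff_monomial, if_neg fun h => hr (Finsupp.equivFunOnFinite.symm.injective h)]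
  · intro hr
    exact absurd (by simp [hN]) hr

theorem IsPowerSeriesExpansion.unique {m : ℕ} {f : (Fin m → ℝ) → (Fin m → ℝ) → ℝ}
    {c c' : (Fin m → ℕ) × (Fin m → ℕ) → ℝ} (h : IsPowerSeriesExpansion f c)
    (h' : IsPowerSeriesExpansion f c') : c = c' := by
  obtain ⟨ε, hε, H⟩ := h
  obtain ⟨ε', hε', H'⟩ := h'
  let e := Equiv.sumArrowEquivProdArrow (Fin m) (Fin m) ℕ
  have hz := eq_zero_of_hasSum_monomials_zero (σ := Fin m ⊕ Fin m)
    (fun r => c (e r) - c' (e r)) (lt_min hε hε') fun x hx => by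
      have h1 := H (fun i => x (Sum.inl i)) (fun j => x (Sum.inr j))
        (fun i => ⟨(hx _).1, (hx _).2.trans_le (min_le_left _ _)⟩)
        (fun i => ⟨(hx _).1, (hx _).2.trans_le (min_le_left _ _)⟩)
      have h2 := H' (fun i => x (Sum.inl i)) (fun j => x (Sum.inr j))
        (fun i => ⟨(hx _).1, (hx _).2.trans_le (min_le_right _ _)⟩)
        (fun i => ⟨(hx _).1, (hx _).2.trans_le (min_le_right _ _)⟩)
      have h3 := e.hasSum_iff.2 (h1.sub h2)
      rw [sub_self] at h3
      convert! h3 using 2 with r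
      simp only [Function.comp_apply, Fintype.prod_sum_type, e, Equiv.sumArrowEquivProdArrow,
        Equiv.coe_fn_mk]
      ring
  funext r
  have := congrFun hz (e.symm r)
  simp only [Equiv.apply_symm_apply, Pi.zero_apply] at this
  linarith

end Uniqueness

/-! ### Averages over double covers -/

section DoubleCovers

variable {n : ℕ}

theorem sum_perm_fin_two {R : Type*} [AddCommMonoid R] (f : Perm (Fin 2) → R) :
    ∑ q, f q = f 1 + f (swap 0 1) := by
  have : (univ : Finset (Perm (Fin 2))) = {1, swap 0 1} := by decide
  rw [this, Finset.sum_pair (by decide)]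

/-- The two points above a column are to be sent to `x 0` and `x 1`. The sum counts the lifts `q` of
the edge from that column to the row `i` that permit this: both lifts if `i` is not involved, and
exactly one otherwise. -/
theorem sum_compatible_lifts (i : Fin n) (x : Fin 2 → Fin n × Fin 2)
    (hx : Function.Injective x) :
    ∑ q : Perm (Fin 2), ∏ y, (if (x y).1 = i then (if q (x y).2 = y then (1 : ℝ) else 0) else 1) =
      2 * (if (x 0).1 = i ∨ (x 1).1 = i then 1 / 2 else 1) := by
  have hne : x 0 ≠ x 1 := hx.ne (by decide)
  simp only [Fin.prod_univ_two]
  generalize x 0 = a at hne ⊢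
  generalize x 1 = b at hne ⊢
  obtain ⟨a, y⟩ := a
  obtain ⟨b, z⟩ := b
  rw [sum_perm_fin_two]
  fin_cases y <;> fin_cases z <;> by_cases ha : a = i <;> by_cases hb : b = i <;>
    simp_all [one_add_one_eq_two]

theorem sum_pi_pi_prod (h : Fin n → Fin n → Perm (Fin 2) → ℝ) :
    ∑ P : Fin n → Fin n → Perm (Fin 2), ∏ j, ∏ i, h i j (P i j) =
      ∏ j, ∏ i, ∑ q, h i j q := by
  rw [Finset.prod_comm]
  simp only [Finset.prod_univ_sum, Fintype.piFinset_univ]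
  exact Finset.sum_congr rfl fun P _ => Finset.prod_comm

/-- The probability that the random lifts of the edges at a column permit two given distinct points,
in the rows `a` and `b`, as the images of the two points above that column. -/
noncomputable def liftWeight (a b : Fin n) : ℝ := if a = b then 1 / 2 else 1 / 4

theorem prod_ite_or (a b : Fin n) :
    ∏ i, (if a = i ∨ b = i then (1 / 2 : ℝ) else 1) = liftWeight a b := by
  unfold liftWeight
  rw [Finset.prod_ite, Finset.prod_const, Finset.prod_const_one, mul_one]
  have : (univ.filter fun i => a = i ∨ b = i) = {a, b} := by
    ext i; simp [eq_comm]
  rw [this]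
  split_ifs with h
  · simp [h]
  · rw [Finset.card_pair h]; norm_num

theorem card_fixed (π : Perm (Fin n)) : #{j | π j = j} = n - π.cycleType.sum := by
  have h := Finset.card_filter_add_card_filter_not (s := (univ : Finset (Fin n))) fun j => π j = j
  have h2 : #{j | ¬ π j = j} = π.cycleType.sum := by
    rw [Perm.sum_cycleType]; rfl
  rw [h2, Finset.card_univ, Fintype.card_fin] at h
  omega

theorem prod_liftWeight (σ τ : Perm (Fin n)) :
    ∏ j, liftWeight (σ j) (τ j) = (1 / 4) ^ n * 2 ^ (n - (σ⁻¹ * τ).cycleType.sum) := by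
  have h : ∀ j, liftWeight (σ j) (τ j) = 1 / 4 * if (σ⁻¹ * τ) j = j then 2 else 1 := fun j => by
    have : (σ⁻¹ * τ) j = j ↔ σ j = τ j := by
      rw [Equiv.Perm.mul_apply, Equiv.Perm.inv_eq_iff_eq, eq_comm]
    simp only [liftWeight, this]
    split_ifs <;> norm_num
  simp only [h]
  rw [Finset.prod_mul_distrib, Finset.prod_const, Finset.prod_ite, Finset.prod_const,
    Finset.prod_const_one, mul_one, card_fixed, Finset.card_univ, Fintype.card_fin]

/-- The lifts of the edges at different columns are independent, so that the average of each term of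
the permanent is a product over the columns. -/
theorem average_permanent_liftedMatrix (A : Matrix (Fin n) (Fin n) ℝ) :
    (∑ P : Fin n → Fin n → Perm (Fin 2), (liftedMatrix A P).permanent) /
      (Fintype.card (Fin n → Fin n → Perm (Fin 2)) : ℝ) =
    ∑ ρ : Perm (Fin n × Fin 2), ∏ j, liftWeight (ρ (j, 0)).1 (ρ (j, 1)).1 *
      (A (ρ (j, 0)).1 j * A (ρ (j, 1)).1 j) := by
  have hcard : (Fintype.card (Fin n → Fin n → Perm (Fin 2)) : ℝ) =
      ∏ _j : Fin n, ∏ _i : Fin n, (2 : ℝ) := by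
    simp [Fintype.card_perm]
  have hpos : (∏ _j : Fin n, ∏ _i : Fin n, (2 : ℝ)) ≠ 0 := by positivity
  rw [hcard, div_eq_iff hpos]
  simp only [Matrix.permanent]
  rw [Finset.sum_comm, Finset.sum_mul]
  refine Finset.sum_congr rfl fun ρ _ => ?_
  have hentry : ∀ P : Fin n → Fin n → Perm (Fin 2),
      ∏ x : Fin n × Fin 2, liftedMatrix A P (ρ x) x =
      (∏ j, A (ρ (j, 0)).1 j * A (ρ (j, 1)).1 j) *
      ∏ j, ∏ i, ∏ y, (if (ρ (j, y)).1 = i then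
        (if P i j (ρ (j, y)).2 = y then (1 : ℝ) else 0) else 1) := fun P => by
    rw [Fintype.prod_prod_type, ← Finset.prod_mul_distrib]
    refine Finset.prod_congr rfl fun j _ => ?_
    rw [Finset.prod_comm]
    simp only [Finset.prod_ite_eq, Finset.mem_univ, if_true, Fin.prod_univ_two, liftedMatrix,
      Matrix.of_apply, PEquiv.toMatrix_apply, Equiv.toPEquiv_apply, Option.mem_def,
      Option.some.injEq, Equiv.Perm.permMatrix]
    ring
  simp only [hentry]
  rw [← Finset.mul_sum, sum_pi_pi_prod fun i j q => ∏ y, (if (ρ (j, y)).1 = i then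
        (if q (ρ (j, y)).2 = y then (1 : ℝ) else 0) else 1)]
  simp only [Finset.prod_mul_distrib (f := fun j => liftWeight (ρ (j, 0)).1 (ρ (j, 1)).1)]
  rw [mul_comm (∏ j, liftWeight _ _), mul_assoc]
  congr 1
  rw [← Finset.prod_mul_distrib]
  refine Finset.prod_congr rfl fun j _ => ?_
  rw [← prod_ite_or, ← Finset.prod_mul_distrib]
  refine Finset.prod_congr rfl fun i _ => ?_
  rw [sum_compatible_lifts i (fun y => ρ (j, y)) (ρ.injective.comp (Prod.mk_right_injective j)),
    mul_comm]

/-- A permutation of the double cover, seen as a bijection from the points above the columns to the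
points above the rows, is layered if each layer `{(j, y) | j}` of columns is mapped bijectively onto
the rows. Injectivity suffices, since the sets are finite. -/
def IsLayered (ρ : Perm (Fin n × Fin 2)) : Prop :=
  ∀ y, Function.Injective fun j => (ρ (j, y)).1

/-- A layered permutation is a pair `s 0`, `s 1` of permutations together with, for each row, a
matching `δ` of the two layers with the two points above that row. -/
theorem isLayered_iff (ρ : Perm (Fin n × Fin 2)) :
    IsLayered ρ ↔ ∃ (δ : Fin n → Perm (Fin 2)) (s : Fin 2 → Perm (Fin n)),
      (prodCongrRight δ : Perm (Fin n × Fin 2)) * prodCongrLeft s = ρ := by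
  constructor
  · intro h
    let s : Fin 2 → Perm (Fin n) := fun y =>
      Equiv.ofBijective _ (Finite.injective_iff_bijective.1 (h y))
    have hs : ∀ y j, (ρ (j, y)).1 = s y j := fun y j => rfl
    have hδ : ∀ i, Function.Injective fun y => (ρ ((s y).symm i, y)).2 := fun i y y' hy => by
      have : ρ ((s y).symm i, y) = ρ ((s y').symm i, y') := by
        refine Prod.ext ?_ hy
        rw [hs, hs, Equiv.apply_symm_apply, Equiv.apply_symm_apply]
      exact congrArg Prod.snd (ρ.injective this)
    refine ⟨fun i => Equiv.ofBijective _ (Finite.injective_iff_bijective.1 (hδ i)), s, ?_⟩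
    ext ⟨j, y⟩ : 1
    refine Prod.ext (hs y j).symm ?_
    simp [Equiv.Perm.mul_apply]
  · rintro ⟨δ, s, rfl⟩ y j j' h
    exact (s y).injective h

theorem layered_injective : Function.Injective
    fun x : (Fin n → Perm (Fin 2)) × (Fin 2 → Perm (Fin n)) =>
      (prodCongrRight x.1 : Perm (Fin n × Fin 2)) * prodCongrLeft x.2 := by
  rintro ⟨δ, s⟩ ⟨δ', s'⟩ h
  have h1 : ∀ j y, (s y j, δ (s y j) y) = (s' y j, δ' (s' y j) y) := fun j y =>
    DFunLike.congr_fun h (j, y)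
  have hs : s = s' := by
    ext y j : 2
    exact congrArg Prod.fst (h1 j y)
  subst hs
  refine Prod.ext ?_ rfl
  ext i y : 2
  simpa using congrArg Prod.snd (h1 ((s y).symm i) y)

/-- A 2-regular bipartite multigraph is a union of two perfect matchings: every permutation of the
double cover becomes layered after exchanging the two points above some of the columns. -/
theorem exists_isLayered_mul (ρ : Perm (Fin n × Fin 2)) :
    ∃ ε : Fin n → Perm (Fin 2), IsLayered (ρ * prodCongrRight ε) := by
  obtain ⟨g, hg, hmem⟩ := (Finset.all_card_le_biUnion_card_iff_exists_injective
    fun j : Fin n => (univ : Finset (Fin 2)).image fun y => (ρ (j, y)).1).1 fun s => by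
      have : #(s ×ˢ (univ : Finset (Fin 2))) ≤
          #((s.biUnion fun j => (univ : Finset (Fin 2)).image fun y => (ρ (j, y)).1) ×ˢ
            (univ : Finset (Fin 2))) := by
        refine Finset.card_le_card_of_injOn ρ (fun x hx => ?_) ρ.injective.injOn
        have hx1 := (Finset.mem_product.1 (Finset.mem_coe.1 hx)).1
        simp only [Finset.coe_product, Set.mem_prod, Finset.mem_coe, Finset.mem_univ, and_true,
          Finset.mem_biUnion, Finset.mem_image, true_and]
        exact ⟨x.1, hx1, x.2, rfl⟩
      simpa [Finset.card_product] using this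
  have hex : ∀ j, ∃ y, (ρ (j, y)).1 = g j := fun j => by simpa using hmem j
  choose f hf using hex
  have hsurj := Finite.injective_iff_surjective.1 hg
  have h0 : ∀ j, (swap 0 (f j) : Perm (Fin 2)) 0 = f j := fun j => swap_apply_left _ _
  have h1 : ∀ j, (swap 0 (f j) : Perm (Fin 2)) 1 ≠ f j := fun j => by
    have : ∀ z : Fin 2, (swap 0 z : Perm (Fin 2)) 1 ≠ z := by decide
    exact this _
  have hpig : ∀ a b c : Fin 2, a = b ∨ a = c ∨ b = c := by decide
  refine ⟨fun j => swap 0 (f j), fun y => ?_⟩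
  have hy : y = 0 ∨ y = 1 := by omega
  rcases hy with rfl | rfl
  · intro j j' h
    apply hg
    simpa [Equiv.Perm.mul_apply, hf] using h
  · intro j j' h
    simp only [Equiv.Perm.mul_apply, Equiv.prodCongrRight_apply] at h
    set z := (swap 0 (f j) : Perm (Fin 2)) 1 with hz
    set z' := (swap 0 (f j') : Perm (Fin 2)) 1 with hz'
    -- the row `i` has only two points above it, but three distinct points would be sent there
    obtain ⟨k, hk⟩ := hsurj (ρ (j, z)).1
    rw [← hf k] at hk
    rcases hpig (ρ (j, z)).2 (ρ (j', z')).2 (ρ (k, f k)).2 with e | e | e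
    · exact congrArg Prod.fst (ρ.injective (Prod.ext h e))
    · have := ρ.injective (Prod.ext hk.symm e)
      simp only [Prod.mk.injEq] at this
      obtain ⟨rfl, h2⟩ := this
      exact absurd h2 (h1 _)
    · have := ρ.injective (Prod.ext (h.symm.trans hk.symm) e)
      simp only [Prod.mk.injEq] at this
      obtain ⟨rfl, h2⟩ := this
      exact absurd h2 (h1 _)

/-- Exchanging the points above some columns keeps a layered permutation layered exactly when the
set of these columns is a union of cycles of `(s 0)⁻¹ * s 1`. -/
theorem isLayered_prodCongrLeft_mul_iff (s : Fin 2 → Perm (Fin n)) (ε : Fin n → Perm (Fin 2)) :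
    IsLayered (prodCongrLeft s * prodCongrRight ε : Perm (Fin n × Fin 2)) ↔
      ∀ j, ε j = ε (((s 0)⁻¹ * s 1) j) := by
  have hsep : ∀ a b : Perm (Fin 2), a ≠ b → ∃ y, a y = 0 ∧ b y = 1 := by decide
  have h01 : ∀ a : Fin 2, a = 0 ∨ a = 1 := by decide
  constructor
  · intro h j
    by_contra hne
    obtain ⟨y, hy0, hy1⟩ := hsep _ _ (Ne.symm hne)
    have hk : s 0 (((s 0)⁻¹ * s 1) j) = s 1 j := by simp
    have := @h y (((s 0)⁻¹ * s 1) j) j (by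
      change s (ε _ y) _ = s (ε j y) j
      rw [hy0, hy1]
      exact hk)
    rw [this] at hne
    exact hne rfl
  · intro h y
    have aux : ∀ j j', ε j y = 0 → ε j' y = 1 → s 0 j = s 1 j' → False := by
      intro j j' e0 e1 e
      have hj : ((s 0)⁻¹ * s 1) j' = j := by
        rw [Equiv.Perm.mul_apply, ← e]; simp
      have := h j'
      rw [hj] at this
      rw [this, e0] at e1
      exact absurd e1 (by decide)
    intro j j' hjj
    simp only [Equiv.Perm.mul_apply, Equiv.prodCongrRight_apply, Equiv.prodCongrLeft_apply] at hjj
    rcases h01 (ε j y) with e | e <;> rcases h01 (ε j' y) with e' | e' <;> rw [e, e'] at hjj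
    · exact (s 0).injective hjj
    · exact (aux j j' e e' hjj).elim
    · exact (aux j' j e' e hjj.symm).elim
    · exact (s 1).injective hjj

open Classical in
/-- The number of ways to permute the points above each column that make `ρ` layered. -/
noncomputable def layeringCount (ρ : Perm (Fin n × Fin 2)) : ℕ :=
  #{ε : Fin n → Perm (Fin 2) | IsLayered (ρ * prodCongrRight ε)}

theorem layeringCount_pos (ρ : Perm (Fin n × Fin 2)) : 0 < layeringCount ρ := by
  classical
  obtain ⟨ε, hε⟩ := exists_isLayered_mul ρ
  exact Finset.card_pos.2 ⟨ε, by simpa using hε⟩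

theorem prodCongrRight_mul (ε ε' : Fin n → Perm (Fin 2)) :
    (prodCongrRight (ε * ε') : Perm (Fin n × Fin 2)) = prodCongrRight ε * prodCongrRight ε' := rfl

theorem layeringCount_mul (ρ : Perm (Fin n × Fin 2)) (ε : Fin n → Perm (Fin 2)) :
    layeringCount (ρ * prodCongrRight ε) = layeringCount ρ := by
  classical
  refine Finset.card_bij' (fun ε' _ => ε * ε') (fun ε' _ => ε⁻¹ * ε') ?_ ?_ ?_ ?_
  · intro ε' h
    simpa [prodCongrRight_mul, mul_assoc] using h
  · intro ε' h
    rw [Finset.mem_filter] at h ⊢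
    rw [mul_assoc, ← prodCongrRight_mul, mul_inv_cancel_left]
    exact ⟨Finset.mem_univ _, h.2⟩
  · simp
  · simp

theorem isLayered_prodCongrRight_mul (δ : Fin n → Perm (Fin 2)) (ρ : Perm (Fin n × Fin 2)) :
    IsLayered (prodCongrRight δ * ρ : Perm (Fin n × Fin 2)) ↔ IsLayered ρ := Iff.rfl

/-- The choices `ε` that are constant on the cycles are counted by the closed walk sum of the identity
matrix. -/
theorem layeringCount_layered (δ : Fin n → Perm (Fin 2)) (s : Fin 2 → Perm (Fin n)) :
    (layeringCount (prodCongrRight δ * prodCongrLeft s : Perm (Fin n × Fin 2)) : ℝ) =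
      2 ^ (n - ((s 0)⁻¹ * s 1).cycleType.sum) * 2 ^ ((s 0)⁻¹ * s 1).cycleType.card := by
  classical
  have htr : (1 : Matrix (Perm (Fin 2)) (Perm (Fin 2)) ℝ).trace = 2 := by
    simp [Matrix.trace_one, Fintype.card_perm]
  have h := closedWalkSum_eq (1 : Matrix (Perm (Fin 2)) (Perm (Fin 2)) ℝ)
    (by rw [htr]; norm_num) ((s 0)⁻¹ * s 1)
  simp only [one_pow, htr, Fintype.card_fin, Multiset.map_const', Multiset.prod_replicate] at h
  rw [← h, layeringCount, closedWalkSum]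
  simp only [mul_assoc, isLayered_prodCongrRight_mul, isLayered_prodCongrLeft_mul_iff,
    Matrix.one_apply]
  rw [Finset.card_filter, Nat.cast_sum]
  refine Finset.sum_congr rfl fun ε _ => ?_
  rw [Finset.prod_boole]
  simp only [Finset.mem_univ, forall_true_left]
  split_ifs <;> simp

/-- The sum of a function on the permutations of the double cover that does not depend on the order
of the points above a column. Each `ρ` is replaced by the average over its layerings, and the pairs
of a permutation and a layering of it are then counted by the layering. -/
theorem sum_eq_sum_layered (W : Perm (Fin n × Fin 2) → ℝ)
    (hW : ∀ ρ ε, W (ρ * prodCongrRight ε) = W ρ) :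
    ∑ ρ, W ρ = 2 ^ n * ∑ x : (Fin n → Perm (Fin 2)) × (Fin 2 → Perm (Fin n)),
      W (prodCongrRight x.1 * prodCongrLeft x.2) /
        layeringCount (prodCongrRight x.1 * prodCongrLeft x.2 : Perm (Fin n × Fin 2)) := by
  classical
  calc ∑ ρ, W ρ = ∑ ρ, ∑ ε : Fin n → Perm (Fin 2),
        if IsLayered (ρ * prodCongrRight ε) then
          W (ρ * prodCongrRight ε) / layeringCount (ρ * prodCongrRight ε) else 0 := by
        refine Finset.sum_congr rfl fun ρ _ => ?_
        simp only [hW, layeringCount_mul]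
        rw [← Finset.sum_filter, Finset.sum_const, nsmul_eq_mul]
        have hpos : (layeringCount ρ : ℝ) ≠ 0 := by exact_mod_cast (layeringCount_pos ρ).ne'
        exact (mul_div_cancel₀ _ hpos).symm
    _ = ∑ _ε : Fin n → Perm (Fin 2), ∑ ρ : Perm (Fin n × Fin 2),
          if IsLayered ρ then W ρ / layeringCount ρ else 0 := by
        rw [Finset.sum_comm]
        refine Finset.sum_congr rfl fun ε _ => ?_
        exact Equiv.sum_comp (Equiv.mulRight (prodCongrRight ε : Perm (Fin n × Fin 2)))
          fun ρ => if IsLayered ρ then W ρ / layeringCount ρ else 0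
    _ = _ := by
        rw [Finset.sum_const, Finset.card_univ, nsmul_eq_mul]
        congr 1
        · simp [Fintype.card_perm]
        · rw [← Finset.sum_filter]
          symm
          refine Finset.sum_bij (fun x _ => prodCongrRight x.1 * prodCongrLeft x.2) ?_ ?_ ?_ ?_
          · intro x _
            exact Finset.mem_filter.2 ⟨Finset.mem_univ _, (isLayered_iff _).2 ⟨x.1, x.2, rfl⟩⟩
          · intro x _ x' _ h
            exact layered_injective h
          · intro ρ hρ
            obtain ⟨δ, s, h⟩ := (isLayered_iff ρ).1 (Finset.mem_filter.1 hρ).2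
            exact ⟨(δ, s), Finset.mem_univ _, h⟩
          · intro x _
            rfl

/-- The degree-2 Bethe permanent as a sum over pairs of permutations. -/
theorem bethePermanent_two_sq (A : Matrix (Fin n) (Fin n) ℝ) (hA : ∀ i j, 0 ≤ A i j) :
    bethePermanent 2 A ^ 2 = ∑ σ : Perm (Fin n), ∑ τ : Perm (Fin n),
      (1 / 2) ^ (σ⁻¹ * τ).cycleType.card * ∏ j, (A (σ j) j * A (τ j) j) := by
  have hlw : ∀ a b : Fin n, 0 ≤ liftWeight a b := fun a b => by
    unfold liftWeight; split_ifs <;> norm_num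
  unfold bethePermanent
  rw [average_permanent_liftedMatrix, ← Real.rpow_natCast, ← Real.rpow_mul
    (Finset.sum_nonneg fun ρ _ => Finset.prod_nonneg fun j _ =>
      mul_nonneg (hlw _ _) (mul_nonneg (hA _ _) (hA _ _)))]
  norm_num only [Nat.cast_ofNat, Real.rpow_one]
  rw [sum_eq_sum_layered (fun ρ : Perm (Fin n × Fin 2) =>
    ∏ j, liftWeight (ρ (j, 0)).1 (ρ (j, 1)).1 * (A (ρ (j, 0)).1 j * A (ρ (j, 1)).1 j))]
  · rw [Fintype.sum_prod_type, Finset.sum_comm, ← (finTwoArrowEquiv (Perm (Fin n))).symm.sum_comp,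
      Fintype.sum_prod_type, Finset.mul_sum]
    refine Finset.sum_congr rfl fun σ _ => ?_
    rw [Finset.mul_sum]
    refine Finset.sum_congr rfl fun τ _ => ?_
    simp only [layeringCount_layered]
    simp only [Equiv.Perm.mul_apply, prodCongrRight_apply, prodCongrLeft_apply,
      finTwoArrowEquiv_symm_apply, Matrix.cons_val_zero, Matrix.cons_val_one]
    rw [Finset.sum_const, Finset.card_univ, nsmul_eq_mul, Finset.prod_mul_distrib,
      prod_liftWeight]
    have hc : (Fintype.card (Fin n → Perm (Fin 2)) : ℝ) = 2 ^ n := by simp [Fintype.card_perm]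
    have h4 : (4 : ℝ) ^ n = 2 ^ n * 2 ^ n := by rw [← mul_pow]; norm_num
    rw [hc, div_pow, div_pow, one_pow, one_pow, h4]
    field_simp
  · intro ρ ε
    refine Finset.prod_congr rfl fun j _ => ?_
    have h : ∀ a : Perm (Fin 2), a = 1 ∨ a = swap 0 1 := by decide
    simp only [Equiv.Perm.mul_apply, prodCongrRight_apply]
    rcases h (ε j) with e | e
    · simp [e]
    · rw [e, swap_apply_left, swap_apply_right, mul_comm (A _ j)]
      simp only [liftWeight, eq_comm]

end DoubleCovers

/-! ### Words and block-constant matrices -/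

section Words

open scoped Nat

variable {n m : ℕ}

/-- The sum over pairs of permutations `σ`, `τ` of the product of the corresponding two
generalized diagonals of `A`, weighted by `θ` for each cycle of length at least 2 of `σ⁻¹ * τ`. -/
def pairSum (θ : ℝ) (A : Matrix (Fin n) (Fin n) ℝ) : ℝ :=
  ∑ σ : Perm (Fin n), ∑ τ : Perm (Fin n),
    θ ^ (σ⁻¹ * τ).cycleType.card * ∏ j, (A (σ j) j * A (τ j) j)

theorem permanent_sq (A : Matrix (Fin n) (Fin n) ℝ) : A.permanent ^ 2 = pairSum 1 A := by
  simp [pairSum, Matrix.permanent, sq, Finset.sum_mul_sum, Finset.prod_mul_distrib]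

theorem pairSum_submatrix_left (θ : ℝ) (A : Matrix (Fin n) (Fin n) ℝ) (e : Perm (Fin n)) :
    pairSum θ (A.submatrix e id) = pairSum θ A := by
  unfold pairSum
  refine Fintype.sum_equiv (Equiv.mulLeft e) _ _ fun σ => ?_
  refine Fintype.sum_equiv (Equiv.mulLeft e) _ _ fun τ => ?_
  simp [mul_assoc]

theorem pairSum_submatrix_right (θ : ℝ) (A : Matrix (Fin n) (Fin n) ℝ) (e : Perm (Fin n)) :
    pairSum θ (A.submatrix id e) = pairSum θ A := by
  unfold pairSum
  refine Fintype.sum_equiv (Equiv.mulRight e⁻¹) _ _ fun σ => ?_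
  refine Fintype.sum_equiv (Equiv.mulRight e⁻¹) _ _ fun τ => ?_
  congr 1
  · have : (σ * e⁻¹)⁻¹ * (τ * e⁻¹) = e * (σ⁻¹ * τ) * e⁻¹ := by group
    simp only [Equiv.coe_mulRight]
    rw [this, Perm.cycleType_conj]
  · refine Fintype.prod_equiv e _ _ fun j => ?_
    simp

theorem pairSum_nonneg {θ : ℝ} (hθ : 0 ≤ θ) {A : Matrix (Fin n) (Fin n) ℝ}
    (hA : ∀ i j, 0 ≤ A i j) : 0 ≤ pairSum θ A :=
  Finset.sum_nonneg fun _ _ => Finset.sum_nonneg fun _ _ => mul_nonneg (pow_nonneg hθ _)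
    (Finset.prod_nonneg fun _ _ => mul_nonneg (hA _ _) (hA _ _))

/-- The number of occurrences of each letter in a word. -/
def content (a : Fin n → Fin m) : Fin m → ℕ := fun i => #{j | a j = i}

theorem sum_content (a : Fin n → Fin m) : ∑ i, content a i = n := by
  have := Finset.card_eq_sum_card_fiberwise (f := a) (s := univ) (t := univ) fun _ _ => mem_univ _
  rw [Finset.card_univ, Fintype.card_fin] at this
  exact this.symm

theorem prod_word (a : Fin n → Fin m) (t : Fin m → ℝ) :
    ∏ j, t (a j) = ∏ i, t i ^ content a i := by
  rw [← Finset.prod_fiberwise univ a]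
  refine Finset.prod_congr rfl fun i _ => ?_
  rw [Finset.prod_congr rfl fun j hj => by rw [(Finset.mem_filter.1 hj).2], Finset.prod_const]
  rfl

theorem content_blockIndex (k : Fin m → ℕ) (hk : ∑ i, k i = n) :
    content (blockIndex k hk) = k := by
  subst hk
  funext i
  unfold content blockIndex
  rw [Finset.card_filter, ← finSigmaFinEquiv.sum_comp, Fintype.sum_sigma]
  simp

theorem exists_perm_of_content_eq {a w : Fin n → Fin m} (h : content a = content w) :
    ∃ e : Perm (Fin n), w ∘ e = a := by
  have hc : ∀ i, Fintype.card {j // a j = i} = Fintype.card {j // w j = i} := fun i => by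
    rw [Fintype.card_subtype, Fintype.card_subtype]
    exact congrFun h i
  refine ⟨(Equiv.sigmaFiberEquiv a).symm.trans ((Equiv.sigmaCongrRight fun i =>
    Fintype.equivOfCardEq (hc i)).trans (Equiv.sigmaFiberEquiv w)), ?_⟩
  funext j
  exact (Fintype.equivOfCardEq (hc (a j)) ⟨j, rfl⟩).2

/-- The words with the content of `w` are the rearrangements of `w`, and each of them arises from
`∏ i, (content w i)!` permutations. -/
theorem multiFactorial_mul_sum (G : (Fin n → Fin m) → ℝ)
    (hG : ∀ a (e : Perm (Fin n)), G (a ∘ e) = G a) (w : Fin n → Fin m) :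
    multiFactorial (content w) * ∑ a, (if content a = content w then G a else 0) =
      n ! * G w := by
  classical
  have hstab : (#{σ : Perm (Fin n) | w ∘ σ = w} : ℝ) = multiFactorial (content w) := by
    have := DomMulAct.stabilizer_card w
    rw [Fintype.card_subtype] at this
    rw [this, multiFactorial, Nat.cast_prod]
    refine Finset.prod_congr rfl fun i _ => ?_
    rw [Fintype.card_subtype]
    rfl
  have hfib : ∀ a : Fin n → Fin m, (#{σ : Perm (Fin n) | w ∘ σ = a} : ℝ) =
      if content a = content w then multiFactorial (content w) else 0 := fun a => by
    split_ifs with h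
    · obtain ⟨e, rfl⟩ := exists_perm_of_content_eq h
      rw [← hstab]
      congr 1
      refine Finset.card_bij' (fun σ _ => σ * e⁻¹) (fun σ _ => σ * e) ?_ ?_ ?_ ?_
      · intro σ hσ
        simp only [Finset.mem_filter, Finset.mem_univ, true_and] at hσ ⊢
        funext j
        have := congrFun hσ (e⁻¹ j)
        simpa using this
      · intro σ hσ
        simp only [Finset.mem_filter, Finset.mem_univ, true_and] at hσ ⊢
        funext j
        exact congrFun hσ (e j)
      · simp
      · simp
    · rw [Finset.card_eq_zero.2, Nat.cast_zero]
      refine Finset.filter_eq_empty_iff.2 fun σ _ hσ => h ?_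
      funext i
      refine Finset.card_bij (fun j _ => σ j) ?_ (fun _ _ _ _ hjj => σ.injective hjj) ?_
      · intro j hj
        rw [← hσ] at hj
        simpa using hj
      · intro j hj
        refine ⟨σ.symm j, ?_, by simp⟩
        rw [← hσ]
        simpa using hj
  have h1 : ∑ σ : Perm (Fin n), G (w ∘ σ) = n ! * G w := by
    simp [hG, Fintype.card_perm]
  rw [← h1, ← Finset.sum_fiberwise univ (fun σ : Perm (Fin n) => w ∘ σ), Finset.mul_sum]
  refine Finset.sum_congr rfl fun a _ => ?_
  rw [Finset.sum_congr rfl fun σ hσ => by rw [(Finset.mem_filter.1 hσ).2], Finset.sum_const,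
    nsmul_eq_mul, hfib]
  split_ifs <;> simp

/-- The coefficient at `t ^ p * u ^ q`: the sum of `pairSum` over the block-constant matrices
whose rows and columns are labelled by words of contents `p` and `q`, divided by `(n !) ^ 2`. The
length `n` of the words is the sum of `p`; if `q` has another sum, then there are no such words, and
the coefficient is zero. -/
noncomputable def coefficient (θ : ℝ) (B : Matrix (Fin m) (Fin m) ℝ)
    (r : (Fin m → ℕ) × (Fin m → ℕ)) : ℝ :=
  (∑ a : Fin (∑ i, r.1 i) → Fin m, ∑ b : Fin (∑ i, r.1 i) → Fin m,
    if content a = r.1 ∧ content b = r.2 then pairSum θ (B.submatrix a b) else 0) /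
    ((∑ i, r.1 i)! : ℝ) ^ 2

theorem pairSum_blockMatrix (θ : ℝ) (B : Matrix (Fin m) (Fin m) ℝ) (k ℓ : Fin m → ℕ)
    (hk : ∑ i, k i = n) (hℓ : ∑ j, ℓ j = n) :
    pairSum θ (blockMatrix B k ℓ hk hℓ) =
      multiFactorial k * multiFactorial ℓ * coefficient θ B (k, ℓ) := by
  subst hk
  set v := blockIndex k rfl
  set w := blockIndex ℓ hℓ
  have hv : content v = k := content_blockIndex k rfl
  have hw : content w = ℓ := content_blockIndex ℓ hℓ
  have hB : blockMatrix B k ℓ rfl hℓ = B.submatrix v w := rfl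
  have h1 := fun a => multiFactorial_mul_sum (fun b => pairSum θ (B.submatrix a b))
    (fun b e => pairSum_submatrix_right θ (B.submatrix a b) e) w
  have h2 := multiFactorial_mul_sum (fun a => pairSum θ (B.submatrix a w))
    (fun a e => pairSum_submatrix_left θ (B.submatrix a w) e) v
  rw [hw] at h1
  rw [hv] at h2
  have hn : ((∑ i, k i)! : ℝ) ≠ 0 := by positivity
  have hsum : multiFactorial ℓ * ∑ a : Fin (∑ i, k i) → Fin m, ∑ b : Fin (∑ i, k i) → Fin m,
      (if content a = k ∧ content b = ℓ then pairSum θ (B.submatrix a b) else 0) =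
      ((∑ i, k i)! : ℝ) * ∑ a, (if content a = k then pairSum θ (B.submatrix a w) else 0) := by
    rw [Finset.mul_sum, Finset.mul_sum]
    refine Finset.sum_congr rfl fun a _ => ?_
    by_cases ha : content a = k
    · simp only [ha, true_and, if_true]
      exact h1 a
    · simp [ha]
  rw [hB, coefficient, mul_assoc, ← mul_div_assoc, ← mul_div_assoc, hsum, mul_left_comm, h2]
  field_simp

/-- The matrix `diag(t) B diag(u) Bᵀ`. Its powers have the same traces as those of `stateMatrix`, and
it involves no square roots. -/
def transferMatrix (B : Matrix (Fin m) (Fin m) ℝ) (t u : Fin m → ℝ) : Matrix (Fin m) (Fin m) ℝ :=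
  Matrix.of fun x y => ∑ c, t x * u c * (B x c * B y c)

/-- Relabelling the rows by `σ` makes the sum over the words depend on `σ⁻¹ * τ` only, which takes each
value `n !` times. -/
theorem sum_words_pairSum (θ : ℝ) (B : Matrix (Fin m) (Fin m) ℝ) (t u : Fin m → ℝ) :
    ∑ x : (Fin n → Fin m) × (Fin n → Fin m),
      pairSum θ (B.submatrix x.1 x.2) / (n ! : ℝ) ^ 2 * (∏ j, t (x.1 j)) * (∏ j, u (x.2 j)) =
    (∑ π : Perm (Fin n), θ ^ π.cycleType.card * closedWalkSum (transferMatrix B t u) π) / n ! := by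
  have hn : (n ! : ℝ) ≠ 0 := by positivity
  have hpair : ∀ σ τ : Perm (Fin n), ∑ a : Fin n → Fin m, ∑ b : Fin n → Fin m,
      (∏ j, (B (a (σ j)) (b j) * B (a (τ j)) (b j))) * (∏ j, t (a j)) * (∏ j, u (b j)) =
      closedWalkSum (transferMatrix B t u) (σ⁻¹ * τ) := fun σ τ => by
    unfold closedWalkSum
    refine Fintype.sum_equiv (σ.symm.arrowCongr (Equiv.refl (Fin m))) _ _ fun a => ?_
    simp only [transferMatrix, Matrix.of_apply]
    rw [Finset.prod_univ_sum, Fintype.piFinset_univ]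
    refine Finset.sum_congr rfl fun b _ => ?_
    rw [← Equiv.prod_comp σ fun j => t (a j), ← Finset.prod_mul_distrib, ← Finset.prod_mul_distrib]
    refine Finset.prod_congr rfl fun j _ => ?_
    simp
    ring
  have hconst : ∑ σ : Perm (Fin n), ∑ τ : Perm (Fin n),
      θ ^ (σ⁻¹ * τ).cycleType.card * closedWalkSum (transferMatrix B t u) (σ⁻¹ * τ) =
      n ! * ∑ π : Perm (Fin n), θ ^ π.cycleType.card *
        closedWalkSum (transferMatrix B t u) π := by
    have : ∀ σ : Perm (Fin n), ∑ τ : Perm (Fin n),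
        θ ^ (σ⁻¹ * τ).cycleType.card * closedWalkSum (transferMatrix B t u) (σ⁻¹ * τ) =
        ∑ π : Perm (Fin n), θ ^ π.cycleType.card *
          closedWalkSum (transferMatrix B t u) π := fun σ =>
      Equiv.sum_comp (Equiv.mulLeft σ⁻¹) fun π : Perm (Fin n) =>
        θ ^ π.cycleType.card * closedWalkSum (transferMatrix B t u) π
    simp [this, Fintype.card_perm]
  have hswap : ∑ x : (Fin n → Fin m) × (Fin n → Fin m),
      pairSum θ (B.submatrix x.1 x.2) * (∏ j, t (x.1 j)) * (∏ j, u (x.2 j)) =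
      ∑ σ : Perm (Fin n), ∑ τ : Perm (Fin n),
      θ ^ (σ⁻¹ * τ).cycleType.card * closedWalkSum (transferMatrix B t u) (σ⁻¹ * τ) := by
    simp only [pairSum, Finset.sum_mul]
    rw [Finset.sum_comm]
    refine Finset.sum_congr rfl fun σ _ => ?_
    rw [Finset.sum_comm]
    refine Finset.sum_congr rfl fun τ _ => ?_
    rw [← hpair, Finset.mul_sum, Fintype.sum_prod_type]
    refine Finset.sum_congr rfl fun a _ => ?_
    rw [Finset.mul_sum]
    refine Finset.sum_congr rfl fun b _ => ?_
    simp only [Matrix.submatrix_apply]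
    ring
  rw [hconst] at hswap
  rw [eq_div_iff hn, ← mul_right_inj' hn, ← hswap, Finset.sum_mul, Finset.mul_sum]
  refine Finset.sum_congr rfl fun x _ => ?_
  field_simp

/-- The exponential formula for the cycle weights `tr M` of fixed points and `θ * tr (M ^ h)` of cycles
of length `h ≥ 2`. -/
theorem hasSum_words {θ : ℝ} (hθ : 0 ≤ θ) {B : Matrix (Fin m) (Fin m) ℝ} {t u : Fin m → ℝ}
    (hM : ∀ x y, 0 ≤ transferMatrix B t u x y) (htr : (transferMatrix B t u).trace ≠ 0)
    (hs : Summable fun h : ℕ => (transferMatrix B t u ^ (h + 2)).trace / ((h : ℝ) + 2)) :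
    HasSum (fun n : ℕ => ∑ x : (Fin n → Fin m) × (Fin n → Fin m),
      pairSum θ (B.submatrix x.1 x.2) / (n ! : ℝ) ^ 2 * (∏ j, t (x.1 j)) * (∏ j, u (x.2 j)))
      (Real.exp ((transferMatrix B t u).trace +
        ∑' h : ℕ, θ * ((transferMatrix B t u ^ (h + 2)).trace / ((h : ℝ) + 2)))) := by
  set M := transferMatrix B t u with hMdef
  have hMpow : ∀ h x y, 0 ≤ (M ^ h) x y := fun h => by
    induction h with
    | zero =>
      intro x y
      rw [pow_zero, Matrix.one_apply]
      split_ifs <;> norm_num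
    | succ h ih =>
      intro x y
      rw [pow_succ, Matrix.mul_apply]
      exact Finset.sum_nonneg fun z _ => mul_nonneg (ih x z) (hM z y)
  have htrn : ∀ h, 0 ≤ (M ^ h).trace := fun h => Finset.sum_nonneg fun x _ => hMpow h x x
  let p : ℕ → ℝ := fun h => if h = 1 then M.trace else θ * (M ^ h).trace
  have hp : ∀ h, 0 ≤ p h := fun h => by
    simp only [p]
    split_ifs
    · simpa using htrn 1
    · exact mul_nonneg hθ (htrn h)
  have hp2 : ∀ h : ℕ, p (h + 2) / ((h : ℝ) + 2) = θ * ((M ^ (h + 2)).trace / ((h : ℝ) + 2)) :=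
    fun h => by simp [p, mul_div_assoc]
  have hp1 : p 1 = M.trace := if_pos rfl
  have key := hasSum_cycleIndex p hp (by simp only [hp2]; exact hs.mul_left θ)
  simp only [hp2, hp1] at key
  convert! key using 2 with n
  rw [sum_words_pairSum]
  congr 1
  refine Finset.sum_congr rfl fun π _ => ?_
  rw [closedWalkSum_eq M htr, Fintype.card_fin]
  have : π.cycleType.map p = π.cycleType.map fun h => θ * (M ^ h).trace := by
    refine Multiset.map_congr rfl fun h hh => if_neg ?_
    have := Perm.two_le_of_mem_cycleType hh
    omega
  rw [this, Multiset.prod_map_mul, Multiset.map_const', Multiset.prod_replicate]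
  ring

/-- The series over the length of the words, regrouped by the contents of the words. -/
theorem hasSum_coefficient {θ : ℝ} (hθ : 0 ≤ θ) {B : Matrix (Fin m) (Fin m) ℝ}
    (hB : ∀ i j, 0 ≤ B i j) {t u : Fin m → ℝ} (ht : ∀ i, 0 ≤ t i) (hu : ∀ i, 0 ≤ u i)
    {S : ℝ} (hS : HasSum (fun n : ℕ => ∑ x : (Fin n → Fin m) × (Fin n → Fin m),
      pairSum θ (B.submatrix x.1 x.2) / (n ! : ℝ) ^ 2 * (∏ j, t (x.1 j)) * (∏ j, u (x.2 j))) S) :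
    HasSum (fun r : (Fin m → ℕ) × (Fin m → ℕ) =>
      coefficient θ B r * (∏ i, t i ^ r.1 i) * (∏ j, u j ^ r.2 j)) S := by
  classical
  let T : (Σ n : ℕ, (Fin n → Fin m) × (Fin n → Fin m)) → ℝ := fun x =>
    pairSum θ (B.submatrix x.2.1 x.2.2) / (x.1 ! : ℝ) ^ 2 * (∏ j, t (x.2.1 j)) *
      (∏ j, u (x.2.2 j))
  have hT0 : ∀ x, 0 ≤ T x := fun x => mul_nonneg (mul_nonneg (div_nonneg
    (pairSum_nonneg hθ fun i j => hB _ _) (by positivity)) (Finset.prod_nonneg fun j _ => ht _))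
    (Finset.prod_nonneg fun j _ => hu _)
  have hfib : ∀ n : ℕ, HasSum (fun x : (Fin n → Fin m) × (Fin n → Fin m) => T ⟨n, x⟩)
      (∑ x : (Fin n → Fin m) × (Fin n → Fin m), T ⟨n, x⟩) := fun n => hasSum_fintype _
  have hTs : Summable T := (summable_sigma_of_nonneg hT0).2
    ⟨fun n => (hfib n).summable, by
      simp only [fun n => (hfib n).tsum_eq]
      exact hS.summable⟩
  have hT : HasSum T S := by
    have := (hTs.hasSum.sigma hfib).unique hS
    rw [← this]
    exact hTs.hasSum
  let K : (Σ n : ℕ, (Fin n → Fin m) × (Fin n → Fin m)) → (Fin m → ℕ) × (Fin m → ℕ) :=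
    fun x => (content x.2.1, content x.2.2)
  have hT' := ((Equiv.sigmaFiberEquiv K).hasSum_iff).2 hT
  refine hT'.sigma fun r => ?_
  have h1 : HasSum (fun x : (Fin (∑ i, r.1 i) → Fin m) × (Fin (∑ i, r.1 i) → Fin m) =>
      if K ⟨∑ i, r.1 i, x⟩ = r then T ⟨∑ i, r.1 i, x⟩ else 0)
      (coefficient θ B r * (∏ i, t i ^ r.1 i) * (∏ j, u j ^ r.2 j)) := by
    convert! hasSum_fintype _ using 1
    rw [coefficient, Fintype.sum_prod_type, mul_assoc, Finset.sum_div, Finset.sum_mul]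
    refine Finset.sum_congr rfl fun a _ => ?_
    rw [Finset.sum_div, Finset.sum_mul]
    refine Finset.sum_congr rfl fun b _ => ?_
    simp only [K, Prod.ext_iff]
    split_ifs with h
    · simp only [T]
      rw [prod_word a, prod_word b, h.1, h.2, mul_assoc]
    · simp
  have h2 : HasSum (fun x => if K x = r then T x else 0)
      (coefficient θ B r * (∏ i, t i ^ r.1 i) * (∏ j, u j ^ r.2 j)) := by
    rw [← (sigma_mk_injective (i := ∑ i, r.1 i)).hasSum_iff]
    · exact h1
    · rintro ⟨n, a, b⟩ hx
      refine if_neg fun h => hx ?_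
      have : n = ∑ i, r.1 i := by
        rw [← sum_content a, ← h]
      subst this
      exact ⟨(a, b), rfl⟩
  rw [← (Subtype.val_injective (p := fun x => K x = r)).hasSum_iff] at h2
  · convert! h2 using 2 with x
    simp [x.2, Equiv.sigmaFiberEquiv]
  · intro x hx
    exact if_neg fun h => hx ⟨⟨x, h⟩, rfl⟩

end Words

/-! ### The expansions of the two generating functions -/

section Expansion

variable {m : ℕ}

theorem trace_mul_pow_comm {R : Type*} [CommRing R] (X Y : Matrix (Fin m) (Fin m) R) (h : ℕ) :
    ((X * Y) ^ h).trace = ((Y * X) ^ h).trace := by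
  cases h with
  | zero => simp
  | succ h =>
    have hcomm : X * (Y * X) ^ h = (X * Y) ^ h * X := by
      induction h with
      | zero => simp
      | succ h ih => rw [pow_succ, ← mul_assoc, ih, pow_succ]; simp only [mul_assoc]
    rw [pow_succ, ← mul_assoc, ← hcomm, mul_assoc, Matrix.trace_mul_comm, pow_succ, mul_assoc]

theorem trace_stateMatrix_pow (B : Matrix (Fin m) (Fin m) ℝ) {t u : Fin m → ℝ}
    (hu : ∀ j, 0 ≤ u j) (h : ℕ) :
    (stateMatrix B t u ^ h).trace = (transferMatrix B t u ^ h).trace := by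
  have h1 : stateMatrix B t u = (Matrix.diagonal (fun j => Real.sqrt (u j)) * B.transpose) *
      (Matrix.diagonal t * B * Matrix.diagonal (fun j => Real.sqrt (u j))) := by
    simp only [stateMatrix, mul_assoc]
  rw [h1, trace_mul_pow_comm]
  congr 2
  ext x y
  rw [Matrix.mul_apply]
  simp only [transferMatrix, Matrix.of_apply]
  refine Finset.sum_congr rfl fun c _ => ?_
  rw [Matrix.mul_diagonal, Matrix.diagonal_mul, Matrix.diagonal_mul, Matrix.transpose_apply]
  linear_combination (t x * B x c * B y c) * Real.mul_self_sqrt (hu c)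

theorem summable_trace_pow {M : Matrix (Fin m) (Fin m) ℝ} (hM : ∀ x y, 0 ≤ M x y)
    (hrow : ∀ x, ∑ y, M x y ≤ 1 / 2) : Summable fun h : ℕ => (M ^ h).trace := by
  have hpow : ∀ h : ℕ, (∀ x y, 0 ≤ (M ^ h) x y) ∧ ∀ x, ∑ y, (M ^ h) x y ≤ (1 / 2) ^ h := by
    intro h
    induction h with
    | zero =>
      refine ⟨fun x y => ?_, fun x => by simp [Matrix.one_apply]⟩
      rw [pow_zero, Matrix.one_apply]
      split_ifs <;> norm_num
    | succ h ih =>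
      refine ⟨fun x y => ?_, fun x => ?_⟩
      · rw [pow_succ, Matrix.mul_apply]
        exact Finset.sum_nonneg fun z _ => mul_nonneg (ih.1 x z) (hM z y)
      · simp only [pow_succ, Matrix.mul_apply]
        rw [Finset.sum_comm]
        calc ∑ z, ∑ y, (M ^ h) x z * M z y = ∑ z, (M ^ h) x z * ∑ y, M z y := by
              simp only [Finset.mul_sum]
          _ ≤ ∑ z, (M ^ h) x z * (1 / 2) :=
              Finset.sum_le_sum fun z _ => mul_le_mul_of_nonneg_left (hrow z) (ih.1 x z)
          _ = (∑ z, (M ^ h) x z) * (1 / 2) := by rw [Finset.sum_mul]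
          _ ≤ (1 / 2) ^ h * (1 / 2) := mul_le_mul_of_nonneg_right (ih.2 x) (by norm_num)
  refine Summable.of_nonneg_of_le (fun h => Finset.sum_nonneg fun x _ => (hpow h).1 x x)
    (fun h => ?_) ((summable_geometric_of_lt_one (by norm_num) one_half_lt_one).mul_left (m : ℝ))
  calc (M ^ h).trace ≤ ∑ x, ∑ y, (M ^ h) x y :=
        Finset.sum_le_sum fun x _ =>
          Finset.single_le_sum (f := fun y => (M ^ h) x y) (fun y _ => (hpow h).1 x y)
            (Finset.mem_univ x)
    _ ≤ ∑ _x : Fin m, (1 / 2) ^ h := Finset.sum_le_sum fun x _ => (hpow h).2 x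
    _ = m * (1 / 2) ^ h := by simp

/-- The expansion for all `θ`, on a box on which the row sums of the transfer matrix are at most
`1 / 2`. -/
theorem exists_expansion (hm : 0 < m) {B : Matrix (Fin m) (Fin m) ℝ} (hB : ∀ i j, 0 < B i j) :
    ∃ ε : ℝ, 0 < ε ∧ ∀ t u : Fin m → ℝ, (∀ i, 0 < t i ∧ t i < ε) → (∀ j, 0 < u j ∧ u j < ε) →
      (Summable fun h : ℕ => (transferMatrix B t u ^ (h + 2)).trace / ((h : ℝ) + 2)) ∧
      ∀ θ : ℝ, 0 ≤ θ → HasSum (fun r : (Fin m → ℕ) × (Fin m → ℕ) =>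
        coefficient θ B r * (∏ i, t i ^ r.1 i) * (∏ j, u j ^ r.2 j))
        (Real.exp ((transferMatrix B t u).trace +
          ∑' h : ℕ, θ * ((transferMatrix B t u ^ (h + 2)).trace / ((h : ℝ) + 2)))) := by
  have : Nonempty (Fin m) := ⟨⟨0, hm⟩⟩
  set K : ℝ := ∑ x, ∑ y, ∑ c, B x c * B y c with hK
  have hterm : ∀ x y c, 0 < B x c * B y c := fun x y c => mul_pos (hB _ _) (hB _ _)
  have hKpos : 0 < K := Finset.sum_pos (fun x _ => Finset.sum_pos (fun y _ =>
    Finset.sum_pos (fun c _ => hterm x y c) univ_nonempty) univ_nonempty) univ_nonempty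
  refine ⟨min 1 (1 / (2 * K)), lt_min one_pos (by positivity), fun t u ht hu => ?_⟩
  have hentry : ∀ x y, 0 < transferMatrix B t u x y := fun x y =>
    Finset.sum_pos (fun c _ => mul_pos (mul_pos (ht x).1 (hu c).1) (hterm x y c)) univ_nonempty
  have hrow : ∀ x, ∑ y, transferMatrix B t u x y ≤ 1 / 2 := fun x => by
    calc ∑ y, transferMatrix B t u x y ≤ ∑ y, ∑ c, 1 / (2 * K) * (B x c * B y c) := by
          refine Finset.sum_le_sum fun y _ => ?_
          simp only [transferMatrix, Matrix.of_apply]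
          refine Finset.sum_le_sum fun c _ => mul_le_mul_of_nonneg_right ?_ (hterm x y c).le
          have h1 : t x ≤ 1 := ((ht x).2.trans_le (min_le_left _ _)).le
          have h2 : u c ≤ 1 / (2 * K) := ((hu c).2.trans_le (min_le_right _ _)).le
          exact (mul_le_of_le_one_left (hu c).1.le h1).trans h2
      _ = 1 / (2 * K) * ∑ y, ∑ c, B x c * B y c := by simp only [Finset.mul_sum]
      _ ≤ 1 / (2 * K) * K := by
          refine mul_le_mul_of_nonneg_left ?_ (by positivity)
          exact Finset.single_le_sum (f := fun x => ∑ y, ∑ c, B x c * B y c)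
            (fun x _ => Finset.sum_nonneg fun y _ => Finset.sum_nonneg fun c _ =>
              (hterm x y c).le) (Finset.mem_univ x)
      _ = 1 / 2 := by field_simp
  have hsum := summable_trace_pow (fun x y => (hentry x y).le) hrow
  have hs : Summable fun h : ℕ => (transferMatrix B t u ^ (h + 2)).trace / ((h : ℝ) + 2) := by
    have h2 := (summable_nat_add_iff (f := fun h => (transferMatrix B t u ^ h).trace) 2).2 hsum
    refine Summable.of_norm_bounded h2.abs fun h => ?_
    rw [Real.norm_eq_abs, abs_div, abs_of_pos (by positivity : (0 : ℝ) < h + 2)]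
    exact div_le_self (abs_nonneg _) (by have : (0 : ℝ) ≤ h := Nat.cast_nonneg h; linarith)
  refine ⟨hs, fun θ hθ => hasSum_coefficient hθ (fun i j => (hB i j).le) (fun i => (ht i).1.le)
    (fun i => (hu i).1.le) (hasSum_words hθ (fun x y => (hentry x y).le) ?_ hs)⟩
  exact (Finset.sum_pos (fun x _ => hentry x x) univ_nonempty).ne'

theorem gibbsGF_isPowerSeriesExpansion (hm : 0 < m) {B : Matrix (Fin m) (Fin m) ℝ}
    (hB : ∀ i j, 0 < B i j) : IsPowerSeriesExpansion (gibbsGF B) (coefficient 1 B) := by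
  obtain ⟨ε, hε, H⟩ := exists_expansion hm hB
  refine ⟨ε, hε, fun t u ht hu => ?_⟩
  obtain ⟨hs, h⟩ := H t u ht hu
  convert! h 1 zero_le_one using 1
  simp only [gibbsGF, trace_stateMatrix_pow B fun j => (hu j).1.le, one_mul]
  have hcast : ∀ h : ℕ, ((h + 1 : ℕ) : ℝ) + 1 = h + 2 := fun h => by push_cast; ring
  have hs' : Summable fun h : ℕ => (transferMatrix B t u ^ (h + 1)).trace / ((h : ℝ) + 1) := by
    rw [← summable_nat_add_iff 1]
    simpa only [hcast, add_assoc, one_add_one_eq_two] using hs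
  rw [hs'.tsum_eq_zero_add]
  simp only [hcast, add_assoc, one_add_one_eq_two]
  simp

theorem betheGF_isPowerSeriesExpansion (hm : 0 < m) {B : Matrix (Fin m) (Fin m) ℝ}
    (hB : ∀ i j, 0 < B i j) : IsPowerSeriesExpansion (betheGF B) (coefficient (1 / 2) B) := by
  obtain ⟨ε, hε, H⟩ := exists_expansion hm hB
  refine ⟨ε, hε, fun t u ht hu => ?_⟩
  obtain ⟨hs, h⟩ := H t u ht hu
  convert! h (1 / 2) (by norm_num) using 1
  have h1 := trace_stateMatrix_pow B (t := t) (fun j => (hu j).1.le) 1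
  rw [pow_one, pow_one] at h1
  simp only [betheGF, trace_stateMatrix_pow B fun j => (hu j).1.le, h1]
  congr 3
  funext h
  field_simp

end Expansion

end BlockPermanent

theorem lemma2 (n m : ℕ) (hn : 0 < n) (hm : 0 < m)
    (B : Matrix (Fin m) (Fin m) ℝ) (hB : ∀ i j, 0 < B i j)
    (k ℓ : Fin m → ℕ) (hk0 : ∀ i, 0 < k i) (hℓ0 : ∀ j, 0 < ℓ j)
    (hk : ∑ i, k i = n) (hℓ : ∑ j, ℓ j = n) :
    (∃ cG : (Fin m → ℕ) × (Fin m → ℕ) → ℝ,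
      (∀ c, BlockPermanent.IsPowerSeriesExpansion (BlockPermanent.gibbsGF B) c ↔ c = cG) ∧
      (BlockPermanent.blockMatrix B k ℓ hk hℓ).permanent ^ 2 =
        BlockPermanent.multiFactorial k * BlockPermanent.multiFactorial ℓ * cG (k, ℓ)) ∧
    (∃ cB : (Fin m → ℕ) × (Fin m → ℕ) → ℝ,
      (∀ c, BlockPermanent.IsPowerSeriesExpansion (BlockPermanent.betheGF B) c ↔ c = cB) ∧
      (BlockPermanent.bethePermanent 2 (BlockPermanent.blockMatrix B k ℓ hk hℓ)) ^ 2 =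
        BlockPermanent.multiFactorial k * BlockPermanent.multiFactorial ℓ * cB (k, ℓ)) := by
  have hG := BlockPermanent.gibbsGF_isPowerSeriesExpansion hm hB
  have hBe := BlockPermanent.betheGF_isPowerSeriesExpansion hm hB
  refine ⟨⟨BlockPermanent.coefficient 1 B, fun c => ⟨fun h => h.unique hG, ?_⟩, ?_⟩,
    ⟨BlockPermanent.coefficient (1 / 2) B, fun c => ⟨fun h => h.unique hBe, ?_⟩, ?_⟩⟩
  · rintro rfl; exact hG
  · rw [BlockPermanent.permanent_sq, BlockPermanent.pairSum_blockMatrix]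
  · rintro rfl; exact hBe
  · have hA : ∀ i j, 0 ≤ BlockPermanent.blockMatrix B k ℓ hk hℓ i j := fun i j => (hB _ _).le
    rw [BlockPermanent.bethePermanent_two_sq _ hA]
    exact BlockPermanent.pairSum_blockMatrix (1 / 2) B k ℓ hk hℓ
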